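/- **Theorem 5.7 (T4.1).** Conventions: $\hat f(\xi)=\int_{\mathbb R^d} f(x)e^{-2\pi i x\cdot\xi}\,dx$; $\langle v\rangle=(1+|v|^2)^{1/2}$; $\mathcal F_2G(z,w)=\int_{\mathbb R^{2d}}e^{-2\pi i u\cdot w}G(z,u)\,du$; $\langle\cdot,\cdot\rangle$ for two entries is the $\mathcal S'$–$\mathcal S$ pairing, conjugate-linear in the second entry; $W(f,g)(x,\xi)=\int_{\mathbb R^d} f(x+\tfrac t2)\overline{g(x-\tfrac t2)}e^{-2\pi i t\cdot\xi}\,dt$ is the cross-Wigner distribution. For an operator $T$ mapping $\mathcal S(\mathbb R^d)$ into $L^2(\mathbb R^d)$, a Wigner kernel of $T$ is a $k\in\mathcal S'(\mathbb R^{4d})$ with $$\langle W(Tf,Tg),W(u,v)\rangle=\langle k,W(u,v)\otimes\overline{W(f,g)}\rangle\qquad\text{for all } f,g,u,v\in\mathcal S(\mathbb R^d).$$ A real function $\Phi$ on $\mathbb R^{2d}$ is a tame phase if $\Phi\in C^\infty(\mathbb R^{2d})$, every derivative $\partial^\alpha\Phi$ with $|\alpha|\ge2$ is bounded, and there is $\delta>0$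 with $|\det\partial^2_{x,\eta}\Phi(x,\eta)|\ge\delta$ for all $x,\eta\in\mathbb R^d$. Let $\Phi$ be a tame phase, $\sigma\in\mathcal S(\mathbb R^{2d})$, and let $$T_If(x)=\int_{\mathbb R^d}e^{2\pi i\Phi(x,\xi)}\sigma(x,\xi)\hat f(\xi)\,d\xi,\qquad f\in\mathcal S(\mathbb R^d),$$ be the Fourier integral operator of type I. For $x,\eta,t,r\in\mathbb R^d$ put $$\Phi_2(x,\eta,t,r)=\sum_{|\alpha|=2}\int_0^1(1-\tau)\,\partial^\alpha\Phi\big((x,\eta)+\tau(t,r)/2\big)\,d\tau\,\frac{(t,r)^\alpha}{2\,\alpha!},$$ $$\widetilde\Phi_2(x,\eta,t,r)=\sum_{|\alpha|=2}\int_0^1(1-\tau)\,\partial^\alpha\Phi\big((x,\eta)-\tau(t,r)/2\big)\,d\tau\,\frac{(t,r)^\alpha}{2\,\alpha!},$$ $$\tilde\sigma(x,\eta,t,r)=e^{2\pi i[\Phi_2-\widetilde\Phi_2](x,\eta,t,r)}\,\sigma\big(x+\tfrac t2,\eta+\tfrac r2\big)\,\overline{\sigma\big(x-\tfrac t2,\eta-\tfrac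 r2\big)},$$ and, for $N\in\mathbb N$ and $u=(t,r)$, $a_N(x,\eta,t,r)=(1-\Delta_u)^N\tilde\sigma(x,\eta,t,r)$; the function $\tilde\sigma(x,\eta,\cdot)$ is smooth on $\mathbb R^{2d}$. Then $T_I$ maps $\mathcal S(\mathbb R^d)$ into $L^2(\mathbb R^d)$ and has exactly one Wigner kernel. This kernel is given by a continuous function $k_I$ on $\mathbb R^{4d}$, and for all $x,\xi,y,\eta\in\mathbb R^d$ $$k_I(x,\xi,y,\eta)=\int_{\mathbb R^{2d}}e^{-2\pi i[t\cdot(\xi-\Phi_x(x,\eta))+r\cdot(y-\Phi_\eta(x,\eta))]}\,\tilde\sigma(x,\eta,t,r)\,dt\,dr,$$ and for every $N\in\mathbb N$ $$k_I(x,\xi,y,\eta)=\frac{1}{\langle2\pi(y-\Phi_\eta(x,\eta),\,\xi-\Phi_x(x,\eta))\rangle^{2N}}\;\mathcal F_2a_N\big(x,\eta,\,\xi-\Phi_x(x,\eta),\,y-\Phi_\eta(x,\eta)\big),$$ where $\tilde\sigma(x,\eta,\cdot)$ and $a_N(x,\eta,\cdot)$ are integrable over $\mathbb R^{2d}$. 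-/

import Mathlib

open MeasureTheory
open scoped SchwartzMap FourierTransform ComplexConjugate ContDiff

noncomputable section

namespace WignerFIO

/-- Configuration space `ℝᵈ`, with the Euclidean norm. -/
abbrev Rd (d : ℕ) := EuclideanSpace ℝ (Fin d)

/-- Phase space `ℝ²ᵈ = ℝᵈ × ℝᵈ`, with the Euclidean norm, inner product and Lebesgue measure. -/
abbrev Phase (d : ℕ) := WithLp 2 (Rd d × Rd d)

/-- The point `(x, ξ)` of phase space. -/
def pt {d : ℕ} (x ξ : Rd d) : Phase d := WithLp.toLp 2 (x, ξ)

/-- The coordinate vectors of phase space: `inl i` is the `i`-th coordinate of the first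
`ℝᵈ`-variable, `inr i` the `i`-th coordinate of the second one. -/
def coordVec {d : ℕ} : Fin d ⊕ Fin d → Phase d
  | .inl i => pt (EuclideanSpace.single i 1) 0
  | .inr i => pt 0 (EuclideanSpace.single i 1)

/-- The coordinates of a point of phase space. -/
def coord {d : ℕ} (u : Phase d) : Fin d ⊕ Fin d → ℝ
  | .inl i => u.fst i
  | .inr i => u.snd i

/-- The partial derivative `∂ᵢ f`. -/
def pderiv {d : ℕ} (i : Fin d ⊕ Fin d) (f : Phase d → ℝ) (z : Phase d) : ℝ :=
  fderiv ℝ f z (coordVec i)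

/-- The partial derivative `∂^α f` for a multi-index `α ∈ ℕ²ᵈ`. -/
def multiDeriv {d : ℕ} (α : Fin d ⊕ Fin d → ℕ) (f : Phase d → ℝ) : Phase d → ℝ :=
  ((List.finRange d).map Sum.inl ++ (List.finRange d).map Sum.inr).foldr
    (fun i g => (pderiv i)^[α i] g) f

/-- The mixed Hessian `∂²_{x,η} Φ = (∂_{x_i} ∂_{η_j} Φ)_{i,j}`. -/
def mixedHessian {d : ℕ} (Φ : Phase d → ℝ) (z : Phase d) : Matrix (Fin d) (Fin d) ℝ :=
  Matrix.of fun i j => pderiv (.inl i) (pderiv (.inr j) Φ) z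

/-- Tame phase functions: smooth, all derivatives of order at least two bounded, and the mixed
Hessian uniformly non-degenerate. (Boundedness of all `∂^α Φ` with `|α| = n` is boundedness of
the `n`-th Fréchet derivative.) -/
structure IsTamePhase {d : ℕ} (Φ : Phase d → ℝ) : Prop where
  smooth : ContDiff ℝ ∞ Φ
  bounded : ∀ n : ℕ, 2 ≤ n → ∃ C : ℝ, ∀ z, ‖iteratedFDeriv ℝ n Φ z‖ ≤ C
  nondegenerate : ∃ δ : ℝ, 0 < δ ∧ ∀ z, δ ≤ |(mixedHessian Φ z).det|

/-- The gradient `Φ_x(x, η)`. -/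
def gradX {d : ℕ} (Φ : Phase d → ℝ) (x η : Rd d) : Rd d := gradient (fun x' => Φ (pt x' η)) x

/-- The gradient `Φ_η(x, η)`. -/
def gradEta {d : ℕ} (Φ : Phase d → ℝ) (x η : Rd d) : Rd d := gradient (fun η' => Φ (pt x η')) η

/-- The FIO of type I with phase `Φ` and symbol `σ`:
`T f (x) = ∫ e^{2πiΦ(x,ξ)} σ(x,ξ) f̂(ξ) dξ`, where `f̂(ξ) = ∫ f(x) e^{-2πi x·ξ} dx`. -/
def fioI {d : ℕ} (Φ : Phase d → ℝ) (σ : 𝓢(Phase d, ℂ)) (f : 𝓢(Rd d, ℂ)) (x : Rd d) : ℂ :=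
  ∫ ξ : Rd d, Complex.exp (2 * Real.pi * Complex.I * (Φ (pt x ξ) : ℂ)) * σ (pt x ξ) *
    𝓕 (f : Rd d → ℂ) ξ

/-- The cross-Wigner distribution
`W(f,g)(x,ξ) = ∫ f(x + t/2) conj(g(x - t/2)) e^{-2πi t·ξ} dt`, at the point `z = (x,ξ)`. -/
def crossWigner {d : ℕ} (f g : Rd d → ℂ) (z : Phase d) : ℂ :=
  ∫ t : Rd d, f (z.fst + (1 / 2 : ℝ) • t) * conj (g (z.fst - (1 / 2 : ℝ) • t)) *
    Complex.exp (-(2 * Real.pi * Complex.I * (inner ℝ t z.snd : ℂ)))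

/-- `κ ∈ 𝓢'(ℝ⁴ᵈ)` is a Wigner kernel of `T`, for an operator `T` mapping Schwartz functions on
`ℝᵈ` to functions in `L²(ℝᵈ)`: for all Schwartz `f, g, u, v`,
`⟨W(Tf,Tg), W(u,v)⟩ = ⟨κ, W(u,v) ⊗ conj W(f,g)⟩`.
The brackets are conjugate-linear in the second entry, i.e. `⟨κ, Θ⟩` is `κ` applied to
`conj Θ`; here `Ψ = conj (W(u,v) ⊗ conj W(f,g)) = conj W(u,v) ⊗ W(f,g)` as a Schwartz function. -/
def IsWignerKernel {d : ℕ} (T : 𝓢(Rd d, ℂ) → Rd d → ℂ) (κ : 𝓢'(Phase d × Phase d, ℂ)) : Prop :=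
  (∀ f, MemLp (T f) 2) ∧
  ∀ (f g u v : 𝓢(Rd d, ℂ)) (Ψ : 𝓢(Phase d × Phase d, ℂ)),
    (∀ z w, Ψ (z, w) = conj (crossWigner u v z) * crossWigner f g w) →
    ∫ z : Phase d, crossWigner (T f) (T g) z * conj (crossWigner u v z) = κ Ψ

/-- The second order Taylor remainder `Φ₂(z, u)` of `Φ` at `z`, for the increment `u / 2`:
`∑_{|α|=2} ∫₀¹ (1-τ) ∂^αΦ(z + τ u/2) dτ u^α / (2 α!)`. -/
def taylorPlus {d : ℕ} (Φ : Phase d → ℝ) (z u : Phase d) : ℝ :=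
  ∑ α ∈ Finset.piAntidiag (Finset.univ : Finset (Fin d ⊕ Fin d)) 2,
    (∫ τ in (0 : ℝ)..1, (1 - τ) * multiDeriv α Φ (z + (τ / 2) • u)) *
      ((∏ i, coord u i ^ α i) / (2 * ∏ i, ((α i).factorial : ℝ)))

/-- The second order Taylor remainder `Φ̃₂(z, u)` of `Φ` at `z`, for the increment `-u / 2`:
`∑_{|α|=2} ∫₀¹ (1-τ) ∂^αΦ(z - τ u/2) dτ u^α / (2 α!)`. -/
def taylorMinus {d : ℕ} (Φ : Phase d → ℝ) (z u : Phase d) : ℝ :=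
  ∑ α ∈ Finset.piAntidiag (Finset.univ : Finset (Fin d ⊕ Fin d)) 2,
    (∫ τ in (0 : ℝ)..1, (1 - τ) * multiDeriv α Φ (z - (τ / 2) • u)) *
      ((∏ i, coord u i ^ α i) / (2 * ∏ i, ((α i).factorial : ℝ)))

/-- The amplitude `σ̃(z, u) = e^{2πi[Φ₂ - Φ̃₂](z,u)} σ(z + u/2) conj(σ(z - u/2))`,
with `z = (x, η)` and `u = (t, r)`. -/
def sigmaTilde {d : ℕ} (Φ : Phase d → ℝ) (σ : 𝓢(Phase d, ℂ)) (z u : Phase d) : ℂ :=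
  Complex.exp (2 * Real.pi * Complex.I * ((taylorPlus Φ z u - taylorMinus Φ z u : ℝ) : ℂ)) *
    σ (z + (1 / 2 : ℝ) • u) * conj (σ (z - (1 / 2 : ℝ) • u))

/-- `a_N(z, u) = (1 - Δ_u)^N σ̃(z, u)`. -/
def ampl {d : ℕ} (Φ : Phase d → ℝ) (σ : 𝓢(Phase d, ℂ)) (N : ℕ) (z : Phase d) : Phase d → ℂ :=
  (fun h : Phase d → ℂ => fun u => h u - Laplacian.laplacian h u)^[N] (sigmaTilde Φ σ z)

/-- The partial Fourier transform with respect to the second variable,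
`𝓕₂ G (z, w) = ∫ e^{-2πi u·w} G(z, u) du`. -/
def fourier₂ {d : ℕ} (G : Phase d → Phase d → ℂ) (z w : Phase d) : ℂ :=
  𝓕 (fun u => G z u) w

/-- The Japanese bracket `⟨v⟩ = (1 + |v|²)^{1/2}`. -/
def bracket {d : ℕ} (v : Phase d) : ℝ := Real.sqrt (1 + ‖v‖ ^ 2)

end WignerFIO

end

/-! Since the derivatives of `Φ` of order at least two are bounded, `Φ` has temperate growth, so `H
= e^{2πiΦ}σ` is a Schwartz function and `T_I f(x) = ∫ H(x,ξ) f̂(ξ) dξ`. In `W(T_I f, T_I g)(x,ξ)`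
the product `f̂(a) conj ĝ(b)` appears under an integral over `(t,a,b)`. In midpoint coordinates `a =
η + r/2`, `b = η - r/2` this product is `∫ e^{-2πi r·y} W(f,g)(y,η) dy`
(`integral_partialFourier_midTensor`). Fubini then exhibits the kernel as the Fourier transform in
`u = (t,r)` of `H(z+u/2) conj H(z-u/2)`, with `z = (x,η)` and frequency `(ξ,y)`
(`crossWigner_kernelOp`). It is continuous and bounded, hence a tempered distribution.

The formulas for the kernel come from Taylor expansion at `z`: `Φ(z+u/2) - Φ(z-u/2) = ∇Φ(z)·u + Φ₂ -
Φ̃₂`. The linear term shifts the frequency by the gradient, and what remains is `σ̃`. On the Fourier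
side `(1-Δ_u)^N` is multiplication by `⟨2πw⟩^{2N}`, which gives the formula with `a_N`.

For uniqueness, the difference of two kernels annihilates every `conj W(u,v) ⊗ W(f,g)`. Shifted and
modulated Gaussians have Wigner distributions `c e^{2πi β·z} e^{-2π|z|²}` with arbitrary `β`
(`exists_crossWigner_eq_gaussian`), so the difference annihilates all modulated Gaussians. These are
total (`eq_zero_of_modulated_gaussian`): Fourier inversion writes Gaussian times `φ` as a
superposition of them, a continuous functional passes through the superposition
(`apply_marginal_eq_zero`), every compactly supported `φ` is divisible by the Gaussian, and such `φ`
are dense. -/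

noncomputable section

/-! ### Temperate growth of phases and of their exponentials -/

section Temperate

variable {E F : Type*} [NormedAddCommGroup E] [NormedSpace ℝ E]
  [NormedAddCommGroup F] [NormedSpace ℝ F]

theorem iteratedDeriv_cexp_real_mul (c : ℂ) (n : ℕ) :
    iteratedDeriv n (fun t : ℝ => Complex.exp (c * t)) =
      fun t : ℝ => c ^ n * Complex.exp (c * t) := by
  induction n with
  | zero => simp
  | succ n ih =>
    rw [iteratedDeriv_succ, ih]
    ext t
    have h : HasDerivAt (fun t : ℝ => Complex.exp (c * t)) (Complex.exp (c * t) * (c * 1)) t :=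
      ((Complex.ofRealCLM.hasDerivAt (x := t)).const_mul c).cexp
    rw [(h.const_mul (c ^ n)).deriv]
    ring

theorem hasTemperateGrowth_cexp_I (a : ℝ) :
    Function.HasTemperateGrowth (fun t : ℝ => Complex.exp ((a * Complex.I) * t)) := by
  refine ⟨(contDiff_const.mul Complex.ofRealCLM.contDiff).cexp, fun n => ⟨0, |a| ^ n, fun x => ?_⟩⟩
  rw [norm_iteratedFDeriv_eq_norm_iteratedDeriv, iteratedDeriv_cexp_real_mul]
  have : (a * Complex.I) * x = ((a * x : ℝ) : ℂ) * Complex.I := by push_cast; ring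
  simp [this, Complex.norm_exp_ofReal_mul_I, -Complex.ofReal_mul]

theorem Function.HasTemperateGrowth.cexp_two_pi_I {f : E → ℝ} (hf : f.HasTemperateGrowth) :
    Function.HasTemperateGrowth
      (fun x => Complex.exp (2 * Real.pi * Complex.I * (f x : ℂ))) := by
  convert (hasTemperateGrowth_cexp_I (2 * Real.pi)).comp hf using 2
  simp

theorem norm_cexp_two_pi_I (t : ℝ) : ‖Complex.exp (2 * Real.pi * Complex.I * (t : ℂ))‖ = 1 := by
  have : 2 * Real.pi * Complex.I * (t : ℂ) = ((2 * Real.pi * t : ℝ) : ℂ) * Complex.I := by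
    push_cast; ring
  rw [this, Complex.norm_exp_ofReal_mul_I]

/-- The bound on a function with a bounded derivative. -/
theorem norm_le_of_fderiv_bound {f : E → F} (hf : Differentiable ℝ f) {k : ℕ} {C : ℝ}
    (hC : ∀ x, ‖fderiv ℝ f x‖ ≤ C * (1 + ‖x‖) ^ k) (x : E) :
    ‖f x‖ ≤ (‖f 0‖ + C) * (1 + ‖x‖) ^ (k + 1) := by
  have hC0 : 0 ≤ C := by simpa using (norm_nonneg _).trans (hC 0)
  have h := (convex_segment (𝕜 := ℝ) (0 : E) x).norm_image_sub_le_of_norm_fderiv_le (𝕜 := ℝ)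
    (f := f) (C := C * (1 + ‖x‖) ^ k) (fun y _ => hf y) (fun y hy => ?_)
    (left_mem_segment ℝ _ _) (right_mem_segment ℝ _ _)
  · have h1 : ‖f x‖ ≤ ‖f 0‖ + C * (1 + ‖x‖) ^ k * ‖x - 0‖ := by
      calc ‖f x‖ = ‖f 0 + (f x - f 0)‖ := by simp
        _ ≤ _ := (norm_add_le _ _).trans (by gcongr)
    rw [sub_zero] at h1
    have h2 : (1 : ℝ) ≤ (1 + ‖x‖) ^ (k + 1) := one_le_pow₀ (by simp)
    calc ‖f x‖ ≤ ‖f 0‖ * 1 + C * (1 + ‖x‖) ^ k * ‖x‖ := by simpa using h1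
      _ ≤ ‖f 0‖ * (1 + ‖x‖) ^ (k + 1) + C * (1 + ‖x‖) ^ k * (1 + ‖x‖) := by
          gcongr; simp
      _ = _ := by ring
  · refine (hC y).trans ?_
    obtain ⟨a, b, ha, hb, hab, rfl⟩ := hy
    have : ‖a • (0 : E) + b • x‖ ≤ ‖x‖ := by
      rw [smul_zero, zero_add, norm_smul, Real.norm_of_nonneg hb]
      exact mul_le_of_le_one_left (norm_nonneg _) (by linarith)
    gcongr

/-- The second derivative has all its derivatives bounded. Integrating twice from the origin adds
one power of `1 + ‖x‖` each time, so the first derivative and then `f` itself grow at most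
polynomially. -/
theorem hasTemperateGrowth_of_bounded_iteratedFDeriv {f : E → F} (hf : ContDiff ℝ ∞ f)
    (hb : ∀ n : ℕ, 2 ≤ n → ∃ C : ℝ, ∀ z, ‖iteratedFDeriv ℝ n f z‖ ≤ C) :
    f.HasTemperateGrowth := by
  have h2 : Function.HasTemperateGrowth (fderiv ℝ (fderiv ℝ f)) := by
    refine ⟨(hf.fderiv_right (m := ∞) (by simp)).fderiv_right (by simp), fun n => ?_⟩
    obtain ⟨C, hC⟩ := hb (n + 2) (by omega)
    refine ⟨0, C, fun x => ?_⟩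
    have := hC x
    rw [iteratedFDeriv_succ_eq_comp_right, Function.comp_apply,
      LinearIsometryEquiv.norm_map, iteratedFDeriv_succ_eq_comp_right, Function.comp_apply,
      LinearIsometryEquiv.norm_map] at this
    simpa using this
  have d1 : Differentiable ℝ (fderiv ℝ f) :=
    (hf.fderiv_right (m := ∞) (by simp)).differentiable (by simp)
  have d0 : Differentiable ℝ f := hf.differentiable (by simp)
  obtain ⟨k, C, hC⟩ := h2.2 0
  have b1 := norm_le_of_fderiv_bound d1 (k := k) (C := C) (by simpa using hC)
  have h1 := Function.HasTemperateGrowth.of_fderiv h2 d1 b1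
  exact Function.HasTemperateGrowth.of_fderiv h1 d0 (norm_le_of_fderiv_bound d0 b1)

end Temperate

/-! ### Tensor products and slices of Schwartz functions -/

section Schwartz

variable {E F : Type*} [NormedAddCommGroup E] [NormedSpace ℝ E]
  [NormedAddCommGroup F] [NormedSpace ℝ F]

namespace SchwartzMap

/-- The complex conjugate of a Schwartz function. -/
def conjugate (f : 𝓢(E, ℂ)) : 𝓢(E, ℂ) :=
  postcompCLM (𝕜 := ℝ) (Complex.conjCLE : ℂ →L[ℝ] ℂ) f

/-- The product `fg` of Schwartz functions. -/
def mulSchwartz (f g : 𝓢(E, ℂ)) : 𝓢(E, ℂ) := pairing (ContinuousLinearMap.mul ℂ ℂ) f g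

@[simp] theorem mulSchwartz_apply (f g : 𝓢(E, ℂ)) (x : E) :
    mulSchwartz f g x = f x * g x := rfl

/-- The weight is `‖L x‖`, not `‖x‖`: for a projection `L` the composite does not decay along the
kernel. For tensor products this suffices, because `‖x‖` is the larger of the norms of the two
projections. -/
theorem decay_comp_linear {G : Type*} [NormedAddCommGroup G] [NormedSpace ℝ G]
    (f : 𝓢(E, ℂ)) (L : G →L[ℝ] E) (hL : ‖L‖ ≤ 1) (k n : ℕ) (x : G) :
    ‖L x‖ ^ k * ‖iteratedFDeriv ℝ n (f ∘ L) x‖ ≤ SchwartzMap.seminorm ℝ k n f := by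
  refine le_trans ?_ (le_seminorm ℝ k n f (L x))
  gcongr
  rw [L.iteratedFDeriv_comp_right (f.smooth ⊤) x (by exact_mod_cast le_top)]
  refine (ContinuousMultilinearMap.norm_compContinuousLinearMap_le _ _).trans ?_
  rw [Finset.prod_const, Finset.card_univ, Fintype.card_fin]
  exact mul_le_of_le_one_right (norm_nonneg _) (pow_le_one₀ (norm_nonneg _) hL)

/-- The tensor product `(x, y) ↦ f x * g y` of two Schwartz functions. -/
def tensor (f : 𝓢(E, ℂ)) (g : 𝓢(F, ℂ)) : 𝓢(E × F, ℂ) where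
  toFun p := f p.1 * g p.2
  smooth' := ((f.smooth ⊤).comp contDiff_fst).mul ((g.smooth ⊤).comp contDiff_snd)
  decay' k n := by
    let A := ContinuousLinearMap.fst ℝ E F
    let B := ContinuousLinearMap.snd ℝ E F
    refine ⟨∑ i ∈ Finset.range (n + 1), (n.choose i : ℝ) *
      (SchwartzMap.seminorm ℝ k i f * SchwartzMap.seminorm ℝ 0 (n - i) g +
        SchwartzMap.seminorm ℝ 0 i f * SchwartzMap.seminorm ℝ k (n - i) g), fun x => ?_⟩
    have h := norm_iteratedFDeriv_mul_le (𝕜 := ℝ) (f := f ∘ A) (g := g ∘ B) (N := ∞)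
      ((f.smooth ⊤).comp A.contDiff) ((g.smooth ⊤).comp B.contDiff) x (n := n)
      (by exact_mod_cast le_top)
    change ‖x‖ ^ k * ‖iteratedFDeriv ℝ n (fun y => (f ∘ A) y * (g ∘ B) y) x‖ ≤ _
    refine (mul_le_mul_of_nonneg_left h (by positivity)).trans ?_
    rw [Finset.mul_sum]
    refine Finset.sum_le_sum fun i _ => ?_
    have hA : ‖A‖ ≤ 1 := ContinuousLinearMap.norm_fst_le _ _ _
    have hB : ‖B‖ ≤ 1 := ContinuousLinearMap.norm_snd_le _ _ _
    have a0 := decay_comp_linear f A hA 0 i x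
    have ak := decay_comp_linear f A hA k i x
    have b0 := decay_comp_linear g B hB 0 (n - i) x
    have bk := decay_comp_linear g B hB k (n - i) x
    rw [pow_zero, one_mul] at a0 b0
    have hx : ‖x‖ ^ k ≤ ‖A x‖ ^ k + ‖B x‖ ^ k := by
      rw [Prod.norm_def]
      rcases max_choice ‖x.1‖ ‖x.2‖ with h | h <;> rw [h]
      · exact le_add_of_nonneg_right (by positivity)
      · exact le_add_of_nonneg_left (by positivity)
    set a := ‖iteratedFDeriv ℝ i (f ∘ A) x‖
    set b := ‖iteratedFDeriv ℝ (n - i) (g ∘ B) x‖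
    calc ‖x‖ ^ k * (n.choose i * a * b) = n.choose i * (‖x‖ ^ k * (a * b)) := by ring
      _ ≤ n.choose i * ((‖A x‖ ^ k + ‖B x‖ ^ k) * (a * b)) := by gcongr
      _ = n.choose i * ((‖A x‖ ^ k * a) * b + a * (‖B x‖ ^ k * b)) := by ring
      _ ≤ _ := by
        have : 0 ≤ SchwartzMap.seminorm ℝ k i f := apply_nonneg _ _
        have : 0 ≤ SchwartzMap.seminorm ℝ 0 i f := apply_nonneg _ _
        gcongr

@[simp] theorem tensor_apply (f : 𝓢(E, ℂ)) (g : 𝓢(F, ℂ)) (p : E × F) :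
    tensor f g p = f p.1 * g p.2 := rfl

theorem hasTemperateGrowth_mk_left (x : E) :
    Function.HasTemperateGrowth (fun y : F => (x, y)) := by
  convert (Function.HasTemperateGrowth.const (x, (0 : F))).add
    (ContinuousLinearMap.inr ℝ E F).hasTemperateGrowth using 2
  simp

/-- The slice `y ↦ f (x, y)` of a Schwartz function. -/
def slice (f : 𝓢(E × F, ℂ)) (x : E) : 𝓢(F, ℂ) :=
  compCLMOfAntilipschitz (K := 1) ℂ (g := fun y : F => (x, y)) (hasTemperateGrowth_mk_left x)
    (AntilipschitzWith.of_le_mul_dist fun y z => by simp [Prod.dist_eq]) f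

@[simp] theorem slice_apply (f : 𝓢(E × F, ℂ)) (x : E) (y : F) : slice f x y = f (x, y) := rfl

theorem iteratedFDeriv_slice (f : 𝓢(E × F, ℂ)) (x : E) (n : ℕ) (y : F) :
    iteratedFDeriv ℝ n (slice f x) y =
      (iteratedFDeriv ℝ n f (x, y)).compContinuousLinearMap
        fun _ => ContinuousLinearMap.inr ℝ E F := by
  have h : (slice f x : F → ℂ) = (fun p => f ((x, 0) + p)) ∘ ContinuousLinearMap.inr ℝ E F := by
    ext y; simp
  have hs : ContDiff ℝ ∞ (fun p => f ((x, 0) + p)) :=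
    (f.smooth ⊤).comp (contDiff_const.add contDiff_id)
  rw [h, (ContinuousLinearMap.inr ℝ E F).iteratedFDeriv_comp_right hs y
    (by exact_mod_cast le_top), iteratedFDeriv_comp_add_left]
  simp

theorem norm_compContinuousLinearMap_inr_le {n : ℕ} (T : (E × F) [×n]→L[ℝ] ℂ) :
    ‖T.compContinuousLinearMap fun _ => ContinuousLinearMap.inr ℝ E F‖ ≤ ‖T‖ := by
  refine (ContinuousMultilinearMap.norm_compContinuousLinearMap_le _ _).trans ?_
  rw [Finset.prod_const, Finset.card_univ, Fintype.card_fin]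
  exact mul_le_of_le_one_right (norm_nonneg _)
    (pow_le_one₀ (norm_nonneg _) (ContinuousLinearMap.norm_inr_le_one _ _ _))

/-- Both `‖x‖` and `‖y‖` are at most `‖(x, y)‖`. Thus the seminorms of slices decay rapidly in the
base point, which makes integrals over slices converge. -/
theorem pow_mul_seminorm_slice_le (f : 𝓢(E × F, ℂ)) (m k n : ℕ) (x : E) :
    ‖x‖ ^ m * SchwartzMap.seminorm ℝ k n (slice f x) ≤
      SchwartzMap.seminorm ℝ (m + k) n f := by
  by_cases hx : ‖x‖ ^ m = 0
  · rw [hx, zero_mul]; exact apply_nonneg _ _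
  have hx' : 0 < ‖x‖ ^ m := lt_of_le_of_ne (by positivity) (Ne.symm hx)
  rw [mul_comm, ← le_div_iff₀ hx']
  refine seminorm_le_bound ℝ k n _ (div_nonneg (apply_nonneg _ _) hx'.le) fun y => ?_
  rw [le_div_iff₀ hx', iteratedFDeriv_slice]
  refine le_trans ?_ (le_seminorm ℝ (m + k) n f (x, y))
  rw [pow_add]
  calc _ ≤ ‖y‖ ^ k * ‖iteratedFDeriv ℝ n f (x, y)‖ * ‖x‖ ^ m := by
        gcongr; exact norm_compContinuousLinearMap_inr_le _
    _ = ‖x‖ ^ m * ‖y‖ ^ k * ‖iteratedFDeriv ℝ n f (x, y)‖ := by ring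
    _ ≤ _ := by
        gcongr
        · exact norm_fst_le (x, y)
        · exact norm_snd_le (x, y)

/-- Mean value inequality in the base point, at the cost of one more derivative. It makes the slice
depend continuously on the base point in the Schwartz topology. -/
theorem seminorm_slice_sub_le (f : 𝓢(E × F, ℂ)) (k n : ℕ) (x x' : E) :
    SchwartzMap.seminorm ℝ k n (slice f x - slice f x') ≤
      SchwartzMap.seminorm ℝ k (n + 1) f * ‖x - x'‖ := by
  refine seminorm_le_bound ℝ k n _ (mul_nonneg (apply_nonneg _ _) (norm_nonneg _)) fun y => ?_
  have hd : Differentiable ℝ (iteratedFDeriv ℝ n f) :=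
    (f.smooth ⊤).differentiable_iteratedFDeriv (by exact_mod_cast WithTop.coe_lt_top n)
  have hs : ∀ x, ContDiff ℝ n (slice f x) := fun x => (slice f x).smooth n
  have h1 : iteratedFDeriv ℝ n (slice f x - slice f x' : 𝓢(F, ℂ)) y =
      (iteratedFDeriv ℝ n f (x, y) - iteratedFDeriv ℝ n f (x', y)).compContinuousLinearMap
        fun _ => ContinuousLinearMap.inr ℝ E F := by
    have : ((slice f x - slice f x' : 𝓢(F, ℂ)) : F → ℂ) = slice f x - slice f x' := rfl
    rw [this, iteratedFDeriv_sub_apply (hs x).contDiffAt (hs x').contDiffAt,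
      iteratedFDeriv_slice, iteratedFDeriv_slice]
    rfl
  rw [h1]
  refine (mul_le_mul_of_nonneg_left (norm_compContinuousLinearMap_inr_le _)
    (by positivity)).trans ?_
  have hder : ∀ z : E, HasFDerivAt (fun z => ‖y‖ ^ k • iteratedFDeriv ℝ n f (z, y))
      (‖y‖ ^ k • (fderiv ℝ (iteratedFDeriv ℝ n f) (z, y)).comp
        (ContinuousLinearMap.inl ℝ E F)) z := fun z => by
    have : HasFDerivAt (fun z => iteratedFDeriv ℝ n f (z, y)) _ z :=
      HasFDerivAt.comp (f := fun e : E => (e, y)) z (hd (z, y)).hasFDerivAt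
        (hasFDerivAt_prodMk_left z y)
    exact this.const_smul (‖y‖ ^ k)
  have := (convex_univ (𝕜 := ℝ) (E := E)).norm_image_sub_le_of_norm_hasFDerivWithin_le
    (f := fun z => ‖y‖ ^ k • iteratedFDeriv ℝ n f (z, y))
    (C := SchwartzMap.seminorm ℝ k (n + 1) f)
    (fun z _ => (hder z).hasFDerivWithinAt) (fun z _ => ?_)
    (Set.mem_univ x') (Set.mem_univ x)
  · rwa [← smul_sub, norm_smul, norm_pow, norm_norm] at this
  · rw [norm_smul, norm_pow, norm_norm]
    refine le_trans ?_ (le_seminorm ℝ k (n + 1) f (z, y))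
    gcongr
    · exact norm_snd_le (z, y)
    · refine (ContinuousLinearMap.opNorm_comp_le _ _).trans ?_
      rw [← norm_fderiv_iteratedFDeriv]
      exact mul_le_of_le_one_right (norm_nonneg _) (ContinuousLinearMap.norm_inl_le_one _ _ _)

theorem pow_mul_norm_le (f : 𝓢(E, ℂ)) (k : ℕ) (x : E) :
    (1 + ‖x‖) ^ k * ‖f x‖ ≤
      2 ^ k * (Finset.Iic (k, 0)).sup (fun m => SchwartzMap.seminorm ℝ m.1 m.2) f := by
  simpa using one_add_le_sup_seminorm_apply (𝕜 := ℝ) (m := (k, 0)) le_rfl le_rfl f x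

theorem exists_norm_le_rpow (f : 𝓢(E, ℂ)) (k : ℕ) :
    ∃ C : ℝ, 0 ≤ C ∧ ∀ x, ‖f x‖ ≤ C * (1 + ‖x‖) ^ (-(k : ℝ)) := by
  refine ⟨2 ^ k * (Finset.Iic (k, 0)).sup (fun m => SchwartzMap.seminorm ℝ m.1 m.2) f,
    mul_nonneg (by positivity) (apply_nonneg _ _), fun x => ?_⟩
  rw [Real.rpow_neg (by positivity), Real.rpow_natCast, ← div_eq_mul_inv,
    le_div_iff₀ (by positivity), mul_comm]
  exact pow_mul_norm_le f k x

theorem continuous_slice (f : 𝓢(E × F, ℂ)) : Continuous (slice f) := by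
  rw [continuous_iff_continuousAt]
  intro x
  refine ((schwartz_withSeminorms ℝ F ℂ).tendsto_nhds _ _).2 fun p ε hε => ?_
  have : Filter.Tendsto (fun x' => SchwartzMap.seminorm ℝ p.1 (p.2 + 1) f * ‖x' - x‖)
      (nhds x) (nhds 0) := by
    have : Continuous fun x' => SchwartzMap.seminorm ℝ p.1 (p.2 + 1) f * ‖x' - x‖ := by fun_prop
    simpa using this.tendsto x
  filter_upwards [this.eventually (gt_mem_nhds hε)] with x' hx'
  exact (seminorm_slice_sub_le f p.1 p.2 x' x).trans_lt hx'

end SchwartzMap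

end Schwartz

/-! ### Gaussians as Schwartz functions -/

section Gaussian

variable {V : Type*} [NormedAddCommGroup V] [InnerProductSpace ℝ V]

theorem contDiff_gaussian (c : ℝ) :
    ContDiff ℝ ∞ (fun x : V => (Real.exp (-c * ‖x‖ ^ 2) : ℂ)) :=
  Complex.ofRealCLM.contDiff.comp ((contDiff_const.mul (contDiff_norm_sq ℝ)).exp)

theorem exists_pow_mul_exp_neg_le {c : ℝ} (hc : 0 < c) (k : ℕ) :
    ∃ C : ℝ, ∀ t : ℝ, 0 ≤ t → (1 + t) ^ k * Real.exp (-c * t ^ 2) ≤ C := by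
  have hC : 0 < min c 1 := lt_min hc one_pos
  refine ⟨k.factorial / (min c 1) ^ k * Real.exp 2, fun t ht => ?_⟩
  have h1 : (min c 1 * (1 + t)) ^ k / k.factorial ≤ Real.exp (min c 1 * (1 + t)) :=
    Real.pow_div_factorial_le_exp _ (by positivity) k
  -- With `m = min c 1` the left side is at most `m(1 + t - t²) ≤ 5m/4`, so 2 is a convenient bound
  -- independent of `c`.
  have h2 : min c 1 * (1 + t) - c * t ^ 2 ≤ 2 := by
    have : min c 1 ≤ 1 := min_le_right _ _
    have : min c 1 * t ^ 2 ≤ c * t ^ 2 := by gcongr; exact min_le_left _ _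
    nlinarith [sq_nonneg (t - 1), mul_nonneg hC.le (sq_nonneg (t - 1))]
  have h3 : (1 + t) ^ k ≤ k.factorial / (min c 1) ^ k * Real.exp (min c 1 * (1 + t)) := by
    rw [div_le_iff₀ (by positivity), mul_pow] at h1
    rw [div_mul_eq_mul_div, le_div_iff₀ (by positivity)]
    linarith
  calc _ ≤ k.factorial / (min c 1) ^ k * Real.exp (min c 1 * (1 + t)) *
        Real.exp (-c * t ^ 2) := by gcongr
    _ = k.factorial / (min c 1) ^ k * Real.exp (min c 1 * (1 + t) - c * t ^ 2) := by
        rw [mul_assoc, ← Real.exp_add]; ring_nf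
    _ ≤ _ := by gcongr

/-- The Gaussian `x ↦ exp (-c ‖x‖²)` as a Schwartz function. -/
def gaussianSchwartz (V : Type*) [NormedAddCommGroup V] [InnerProductSpace ℝ V] {c : ℝ}
    (hc : 0 < c) : 𝓢(V, ℂ) where
  toFun x := (Real.exp (-c * ‖x‖ ^ 2) : ℂ)
  smooth' := contDiff_gaussian c
  decay' k n := by
    have hq : Function.HasTemperateGrowth (fun x : V => -c * ‖x‖ ^ 2) := by
      fun_prop
    obtain ⟨l, A, hA, hA'⟩ := hq.norm_iteratedFDeriv_le_uniform n
    obtain ⟨C, hC⟩ := exists_pow_mul_exp_neg_le hc (k + l * n)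
    refine ⟨n.factorial * (1 + A) ^ n * C, fun x => ?_⟩
    have hg : ContDiff ℝ ∞ (fun t : ℝ => Complex.exp ((1 : ℂ) * t)) :=
      (contDiff_const.mul Complex.ofRealCLM.contDiff).cexp
    -- Faà di Bruno bound: each derivative of the Gaussian is at most the Gaussian times a power of
    -- `1 + ‖x‖`. The enlarged constant `1 + A` makes the base at least 1, so it is dominated by its
    -- `i`-th power for `i ≥ 1`.
    have h := norm_iteratedFDeriv_comp_le hg hq.1 (n := n) (by exact_mod_cast le_top) x
      (C := Real.exp (-c * ‖x‖ ^ 2)) (D := (1 + A) * (1 + ‖x‖) ^ l) (fun i _ => ?_)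
      (fun i hi hi' => ?_)
    · have he : (fun x : V => (Real.exp (-c * ‖x‖ ^ 2) : ℂ)) =
          (fun t : ℝ => Complex.exp ((1 : ℂ) * t)) ∘ fun x : V => -c * ‖x‖ ^ 2 := by
        ext x; simp
      rw [he]
      have hxk : ‖x‖ ^ k ≤ (1 + ‖x‖) ^ k := by gcongr; simp
      calc _ ≤ (1 + ‖x‖) ^ k * (n.factorial * Real.exp (-c * ‖x‖ ^ 2) *
            ((1 + A) * (1 + ‖x‖) ^ l) ^ n) := by gcongr
        _ = n.factorial * (1 + A) ^ n *
            ((1 + ‖x‖) ^ (k + l * n) * Real.exp (-c * ‖x‖ ^ 2)) := by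
            rw [mul_pow, ← pow_mul, pow_add]; ring
        _ ≤ _ := by gcongr; exact hC _ (norm_nonneg _)
    · rw [norm_iteratedFDeriv_eq_norm_iteratedDeriv, iteratedDeriv_cexp_real_mul]
      rw [Complex.norm_mul, Complex.norm_exp]
      simp [-Complex.ofReal_neg, -Complex.ofReal_mul, -Complex.ofReal_pow]
    · refine (hA' i hi' x).trans ?_
      calc A * (1 + ‖x‖) ^ l ≤ (1 + A) * (1 + ‖x‖) ^ l := by gcongr; simp
        _ ≤ _ := le_self_pow₀ (one_le_mul_of_one_le_of_one_le (by simpa using hA)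
          (one_le_pow₀ (by simp))) (by omega)

@[simp] theorem gaussianSchwartz_apply {c : ℝ} (hc : 0 < c) (x : V) :
    gaussianSchwartz V hc x = (Real.exp (-c * ‖x‖ ^ 2) : ℂ) := rfl

end Gaussian

/-! ### Continuous functionals and integrals of slices -/

/-- Bounded continuous functions with values in a normed group. -/
abbrev BCFunction (X G : Type*) [TopologicalSpace X] [NormedAddCommGroup G] :=
  BoundedContinuousFunction X G

/-- Continuous linear maps between real normed spaces. -/
abbrev CLMap (X G : Type*) [NormedAddCommGroup X] [NormedSpace ℝ X] [NormedAddCommGroup G]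
    [NormedSpace ℝ G] := X →L[ℝ] G

namespace SchwartzMap

variable {E F : Type*} [NormedAddCommGroup E] [NormedSpace ℝ E]
  [NormedAddCommGroup F] [NormedSpace ℝ F]

/-- The bounded continuous function `y ↦ ‖y‖ ^ k • Dⁿ f y`. -/
def weightedDeriv (k n : ℕ) (f : 𝓢(F, ℂ)) : BCFunction F (F [×n]→L[ℝ] ℂ) :=
  BoundedContinuousFunction.ofNormedAddCommGroup (fun y => ‖y‖ ^ k • iteratedFDeriv ℝ n f y)
    (by
      have := (f.smooth ⊤).continuous_iteratedFDeriv (m := n) (by exact_mod_cast le_top)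
      fun_prop)
    (SchwartzMap.seminorm ℝ k n f) fun y => by
      rw [norm_smul, norm_pow, norm_norm]
      exact le_seminorm ℝ k n f y

theorem weightedDeriv_apply (k n : ℕ) (f : 𝓢(F, ℂ)) (y : F) :
    weightedDeriv k n f y = ‖y‖ ^ k • iteratedFDeriv ℝ n f y := rfl

/-- Each Schwartz seminorm becomes the norm of a Banach space of bounded continuous functions.
Bochner integration is then available, although Schwartz space itself is not normed. -/
theorem norm_weightedDeriv (k n : ℕ) (f : 𝓢(F, ℂ)) :
    ‖weightedDeriv k n f‖ = SchwartzMap.seminorm ℝ k n f := by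
  refine le_antisymm (BoundedContinuousFunction.norm_ofNormedAddCommGroup_le _
    (apply_nonneg _ _) _) (seminorm_le_bound ℝ k n f (norm_nonneg (weightedDeriv k n f)) fun y => ?_)
  have := (weightedDeriv k n f).norm_coe_le_norm y
  rwa [weightedDeriv_apply, norm_smul, norm_pow, norm_norm] at this

theorem weightedDeriv_add (k n : ℕ) (f g : 𝓢(F, ℂ)) :
    weightedDeriv k n (f + g) = weightedDeriv k n f + weightedDeriv k n g := by
  ext1 y
  have : ((f + g : 𝓢(F, ℂ)) : F → ℂ) = f + g := rfl
  simp only [weightedDeriv_apply, BoundedContinuousFunction.add_apply, this]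
  rw [iteratedFDeriv_add_apply (f.smooth n).contDiffAt (g.smooth n).contDiffAt, smul_add]

theorem weightedDeriv_smul (k n : ℕ) (c : ℝ) (f : 𝓢(F, ℂ)) :
    weightedDeriv k n (c • f) = c • weightedDeriv k n f := by
  ext1 y
  have : ((c • f : 𝓢(F, ℂ)) : F → ℂ) = c • (f : F → ℂ) := rfl
  rw [BoundedContinuousFunction.smul_apply, weightedDeriv_apply, weightedDeriv_apply, this,
    iteratedFDeriv_const_smul_apply (f.smooth n).contDiffAt, smul_comm]

/-- The finite family of `weightedDeriv`s indexed by `s`. -/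
def weightedDerivs (s : Finset (ℕ × ℕ)) :
    𝓢(F, ℂ) →ₗ[ℝ] ((p : s) → BCFunction F (F [×p.1.2]→L[ℝ] ℂ)) where
  toFun f p := weightedDeriv p.1.1 p.1.2 f
  map_add' f g := by ext1 p; exact weightedDeriv_add _ _ f g
  map_smul' c f := by ext1 p; exact weightedDeriv_smul _ _ c f

theorem sup_seminorm_le_norm_weightedDerivs (s : Finset (ℕ × ℕ)) (f : 𝓢(F, ℂ)) :
    s.sup (schwartzSeminormFamily ℝ F ℂ) f ≤ ‖weightedDerivs s f‖ := by
  refine Seminorm.finset_sup_apply_le (norm_nonneg _) fun p hp => ?_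
  rw [schwartzSeminormFamily_apply, ← norm_weightedDeriv]
  exact norm_le_pi_norm (weightedDerivs s f) ⟨p, hp⟩

theorem continuous_weightedDeriv_slice (k n : ℕ) (f : 𝓢(E × F, ℂ)) :
    Continuous fun x => weightedDeriv k n (slice f x) := by
  refine continuous_iff_continuousAt.2 fun x => ?_
  rw [ContinuousAt, tendsto_iff_norm_sub_tendsto_zero]
  have h : ∀ x', weightedDeriv k n (slice f x') - weightedDeriv k n (slice f x) =
      weightedDeriv k n (slice f x' - slice f x) := fun x' => by
    rw [sub_eq_iff_eq_add, ← weightedDeriv_add, sub_add_cancel]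
  simp_rw [h, norm_weightedDeriv]
  refine squeeze_zero (fun _ => apply_nonneg _ _)
    (fun x' => seminorm_slice_sub_le f k n x' x) ?_
  have : Continuous fun x' => SchwartzMap.seminorm ℝ k (n + 1) f * ‖x' - x‖ := by fun_prop
  simpa using this.tendsto x

variable [MeasurableSpace E] [BorelSpace E] [SecondCountableTopology E]
  {μ : Measure E} [hμ : μ.HasTemperateGrowth]

theorem integrable_weightedDeriv_slice (k n : ℕ) (f : 𝓢(E × F, ℂ)) :
    Integrable (fun x => weightedDeriv k n (slice f x)) μ := by
  have h := integrable_of_le_of_pow_mul_le (μ := μ) (k := 0)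
    (f := fun x => weightedDeriv k n (slice f x))
    (C₁ := SchwartzMap.seminorm ℝ k n f)
    (C₂ := SchwartzMap.seminorm ℝ (0 + μ.integrablePower + k) n f)
    (fun x => ?_) (fun x => ?_) (continuous_weightedDeriv_slice k n f).aestronglyMeasurable
  · exact (integrable_norm_iff
      (continuous_weightedDeriv_slice k n f).aestronglyMeasurable).1 (by simpa using h)
  · rw [norm_weightedDeriv]
    simpa using pow_mul_seminorm_slice_le f 0 k n x
  · rw [norm_weightedDeriv]
    exact pow_mul_seminorm_slice_le f _ k n x

theorem iteratedFDeriv_eq_weightedDeriv (n : ℕ) (f : 𝓢(F, ℂ)) (y : F) :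
    iteratedFDeriv ℝ n f y = weightedDeriv 0 n f y := by
  simp [weightedDeriv_apply]

theorem integrable_iteratedFDeriv_slice (n : ℕ) (f : 𝓢(E × F, ℂ)) (y : F) :
    Integrable (fun x => iteratedFDeriv ℝ n (slice f x) y) μ := by
  simp_rw [iteratedFDeriv_eq_weightedDeriv]
  exact (BoundedContinuousFunction.evalCLM ℝ y).integrable_comp
    (integrable_weightedDeriv_slice (μ := μ) 0 n f)

/-- Induction on `n`, differentiating under the integral. The sup norm of the next derivative of the
slice is an integrable majorant that is uniform in `y`. -/
theorem iteratedFDeriv_integral_slice {f : 𝓢(E × F, ℂ)} {g : 𝓢(F, ℂ)}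
    (hg : ∀ y, g y = ∫ x, f (x, y) ∂μ) (n : ℕ) (y : F) :
    iteratedFDeriv ℝ n g y = ∫ x, iteratedFDeriv ℝ n (slice f x) y ∂μ := by
  induction n generalizing y with
  | zero =>
    simp_rw [iteratedFDeriv_zero_eq_comp, Function.comp_apply]
    rw [hg]
    exact ((continuousMultilinearCurryFin0 ℝ F ℂ).symm.toContinuousLinearEquiv.integral_comp_comm
      _).symm
  | succ n ih =>
    obtain ⟨c, hc⟩ : ∃ c : CLMap F (F [×n]→L[ℝ] ℂ) ≃L[ℝ] (F [×(n + 1)]→L[ℝ] ℂ),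
        ∀ (φ : 𝓢(F, ℂ)) y, iteratedFDeriv ℝ (n + 1) φ y =
          c (fderiv ℝ (iteratedFDeriv ℝ n φ) y) :=
      ⟨(continuousMultilinearCurryLeftEquiv ℝ
        (fun _ : Fin (n + 1) => F) ℂ).symm.toContinuousLinearEquiv, fun φ y => by
          rw [iteratedFDeriv_succ_eq_comp_left]; rfl⟩
    have hc' : ∀ (φ : 𝓢(F, ℂ)) y, fderiv ℝ (iteratedFDeriv ℝ n φ) y =
        c.symm (iteratedFDeriv ℝ (n + 1) φ y) := fun φ y => by
      rw [hc, ContinuousLinearEquiv.symm_apply_apply]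
    have hint : Integrable
        (fun x => (fderiv ℝ (iteratedFDeriv ℝ n (slice f x)) y : CLMap F (F [×n]→L[ℝ] ℂ))) μ := by
      simp_rw [hc']
      exact c.symm.toContinuousLinearMap.integrable_comp
        (integrable_iteratedFDeriv_slice (n + 1) f y)
    have key := hasFDerivAt_integral_of_dominated_of_fderiv_le (μ := μ) (s := Set.univ)
        (F := fun y x => iteratedFDeriv ℝ n (slice f x) y)
        (F' := fun y x => fderiv ℝ (iteratedFDeriv ℝ n (slice f x)) y)
        (bound := fun x => ‖weightedDeriv 0 (n + 1) (slice f x)‖) (x₀ := y)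
        Filter.univ_mem
        (Filter.Eventually.of_forall fun y =>
          (integrable_iteratedFDeriv_slice n f y).aestronglyMeasurable)
        (integrable_iteratedFDeriv_slice n f y)
        hint.aestronglyMeasurable
        (Filter.Eventually.of_forall fun x y _ => by
          rw [norm_fderiv_iteratedFDeriv, iteratedFDeriv_eq_weightedDeriv]
          exact BoundedContinuousFunction.norm_coe_le_norm _ _)
        (integrable_weightedDeriv_slice 0 (n + 1) f).norm
        (Filter.Eventually.of_forall fun x y _ => by
          have hd : Differentiable ℝ (iteratedFDeriv ℝ n (slice f x)) :=
            ((slice f x).smooth ⊤).differentiable_iteratedFDeriv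
              (by exact_mod_cast WithTop.coe_lt_top n)
          exact (hd y).hasFDerivAt)
    have hfun : iteratedFDeriv ℝ n g = fun y => ∫ x, iteratedFDeriv ℝ n (slice f x) y ∂μ :=
      funext ih
    rw [hc, hfun, key.fderiv, ← c.integral_comp_comm]
    simp_rw [hc]

theorem integral_weightedDeriv_slice {f : 𝓢(E × F, ℂ)} {g : 𝓢(F, ℂ)}
    (hg : ∀ y, g y = ∫ x, f (x, y) ∂μ) (k n : ℕ) :
    ∫ x, weightedDeriv k n (slice f x) ∂μ = weightedDeriv k n g := by
  ext1 y
  have := (BoundedContinuousFunction.evalCLM ℝ y).integral_comp_comm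
    (integrable_weightedDeriv_slice (μ := μ) k n f)
  refine this.symm.trans ?_
  simp only [BoundedContinuousFunction.evalCLM_apply, weightedDeriv_apply]
  rw [integral_smul, iteratedFDeriv_integral_slice hg]

/-- In the quotient by the closed subspace `W` the integrand vanishes identically, and the quotient
map commutes with the integral. -/
theorem _root_.Submodule.integral_mem_of_isClosed {X G : Type*} [MeasurableSpace X]
    {ν : Measure X} [NormedAddCommGroup G] [NormedSpace ℝ G] [CompleteSpace G]
    (W : Submodule ℝ G) (hW : IsClosed (W : Set G)) {h : X → G} (hi : Integrable h ν)
    (hm : ∀ x, h x ∈ W) : ∫ x, h x ∂ν ∈ W := by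
  have : IsClosed (W : Set G) := hW
  rw [← Submodule.Quotient.mk_eq_zero]
  have := W.mkQL.integral_comp_comm hi
  change W.mkQL _ = 0
  rw [← this, integral_eq_zero_of_ae]
  exact Filter.Eventually.of_forall fun x => (Submodule.Quotient.mk_eq_zero _).2 (hm x)

/-- A continuous functional that vanishes on all slices of a Schwartz function vanishes on its
marginal. -/
theorem apply_marginal_eq_zero (D : 𝓢(F, ℂ) →L[ℂ] ℂ) {f : 𝓢(E × F, ℂ)} {g : 𝓢(F, ℂ)}
    (hg : ∀ y, g y = ∫ x, f (x, y) ∂μ) (hD : ∀ x, D (slice f x) = 0) : D g = 0 := by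
  -- Continuity controls `D` by finitely many seminorms, hence by the norm of `weightedDerivs s`. It
  -- is enough to approximate `g` in that norm by elements of the span of the slices, on which `D`
  -- vanishes.
  obtain ⟨s, C, -, hC⟩ := Seminorm.bound_of_continuous (schwartz_withSeminorms ℝ F ℂ)
    ((normSeminorm ℝ ℂ).comp (D.toLinearMap.restrictScalars ℝ)) (by
      exact continuous_norm.comp D.continuous)
  have hb : ∀ φ, ‖D φ‖ ≤ C * ‖weightedDerivs s φ‖ := fun φ =>
    (hC φ).trans (mul_le_mul_of_nonneg_left (sup_seminorm_le_norm_weightedDerivs s φ) C.2)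
  let S := Submodule.span ℝ (Set.range (slice f))
  have hS : ∀ φ ∈ S, D φ = 0 := fun φ hφ => by
    induction hφ using Submodule.span_induction with
    | mem φ h => obtain ⟨x, rfl⟩ := h; exact hD x
    | zero => simp
    | add φ ψ _ _ h1 h2 => rw [map_add, h1, h2, add_zero]
    | smul c φ _ h => 
      have : D (c • φ) = c • D φ := (D.toLinearMap.restrictScalars ℝ).map_smul c φ
      rw [this, h, smul_zero]
  let W := (S.map (weightedDerivs s)).topologicalClosure
  have hi : Integrable (fun x => weightedDerivs s (slice f x)) μ :=
    Integrable.of_eval fun p => integrable_weightedDeriv_slice p.1.1 p.1.2 f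
  have hI : ∫ x, weightedDerivs s (slice f x) ∂μ = weightedDerivs s g := by
    ext1 p
    refine Eq.trans ?_ (integral_weightedDeriv_slice hg p.1.1 p.1.2)
    exact ((ContinuousLinearMap.proj (R := ℝ)
      (φ := fun p : s => BCFunction F (F [×p.1.2]→L[ℝ] ℂ)) p).integral_comp_comm hi).symm
  have hmem : weightedDerivs s g ∈ W := by
    rw [← hI]
    refine Submodule.integral_mem_of_isClosed W (Submodule.isClosed_topologicalClosure (S.map (weightedDerivs s))) hi fun x => ?_
    exact Submodule.le_topologicalClosure _
      (Submodule.mem_map_of_mem (Submodule.subset_span ⟨x, rfl⟩))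
  rw [← norm_le_zero_iff]
  refine le_of_forall_pos_le_add fun ε hε => ?_
  have hCpos : (0 : ℝ) < C + 1 := add_pos_of_nonneg_of_pos C.2 one_pos
  obtain ⟨w, hw, hd⟩ := Metric.mem_closure_iff.1 hmem (ε / (C + 1)) (by positivity)
  obtain ⟨φ, hφ, rfl⟩ := hw
  rw [dist_eq_norm, ← map_sub] at hd
  have h1 : D g = D (g - φ) := by rw [map_sub, hS φ hφ, sub_zero]
  rw [zero_add, h1]
  calc _ ≤ C * (ε / (C + 1)) := (hb _).trans (mul_le_mul_of_nonneg_left hd.le C.2)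
    _ ≤ (C + 1) * (ε / (C + 1)) := by gcongr; simp
    _ = ε := by field_simp

end SchwartzMap

namespace SchwartzMap

/-! ### Density of compactly supported functions -/

section Cutoff

variable {V : Type*} [NormedAddCommGroup V] [NormedSpace ℝ V]

/-- The difference vanishes for `‖x‖ < ε⁻¹`. Elsewhere `1 ≤ ε‖x‖`, so one extra power of the weight
is traded for a factor `ε`. -/
theorem seminorm_sub_cutoff_le (φ χ ψ : 𝓢(V, ℂ)) {ε : ℝ} (hε : 0 < ε) (hε1 : ε ≤ 1)
    (hχ : ∀ x, ‖x‖ ≤ 1 → χ x = 1) (hψ : ∀ x, ψ x = χ (ε • x) * φ x) (k m : ℕ) :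
    SchwartzMap.seminorm ℝ k m (φ - ψ) ≤
      ε * (SchwartzMap.seminorm ℝ (k + 1) m φ + ∑ i ∈ Finset.range (m + 1), (m.choose i : ℝ) *
        SchwartzMap.seminorm ℝ 0 i χ * SchwartzMap.seminorm ℝ (k + 1) (m - i) φ) := by
  set A := SchwartzMap.seminorm ℝ (k + 1) m φ + ∑ i ∈ Finset.range (m + 1), (m.choose i : ℝ) *
        SchwartzMap.seminorm ℝ 0 i χ * SchwartzMap.seminorm ℝ (k + 1) (m - i) φ with hA
  have hA0 : 0 ≤ A := add_nonneg (apply_nonneg _ _) (Finset.sum_nonneg fun i _ =>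
    mul_nonneg (mul_nonneg (by positivity) (apply_nonneg _ _)) (apply_nonneg _ _))
  refine seminorm_le_bound ℝ k m _ (by positivity) fun x => ?_
  by_cases hx : ‖x‖ < ε⁻¹
  · have h0 : ((φ - ψ : 𝓢(V, ℂ)) : V → ℂ) =ᶠ[nhds x] fun _ => 0 := by
      filter_upwards [(continuous_norm.tendsto x).eventually (gt_mem_nhds hx)] with y hy
      have : ‖ε • y‖ ≤ 1 := by
        rw [norm_smul, Real.norm_of_nonneg hε.le]
        calc ε * ‖y‖ ≤ ε * ε⁻¹ := by gcongr
          _ = 1 := mul_inv_cancel₀ hε.ne'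
      change φ y - ψ y = 0
      rw [hψ, hχ _ this, one_mul, sub_self]
    rw [(h0.iteratedFDeriv ℝ m).eq_of_nhds]
    simp only [iteratedFDeriv_fun_zero, Pi.zero_apply, norm_zero, mul_zero]
    positivity
  · push Not at hx
    have hx1 : 1 ≤ ε * ‖x‖ := by
      calc (1 : ℝ) = ε * ε⁻¹ := (mul_inv_cancel₀ hε.ne').symm
        _ ≤ _ := by gcongr
    have hsub : ((φ - ψ : 𝓢(V, ℂ)) : V → ℂ) = φ - ψ := rfl
    have hψ' : (ψ : V → ℂ) = fun x => χ (ε • x) * φ x := funext hψ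
    have hχs : ContDiff ℝ ∞ (fun x => χ (ε • x)) := (χ.smooth ⊤).comp (contDiff_const_smul ε)
    have h1 : ‖iteratedFDeriv ℝ m ψ x‖ ≤ ∑ i ∈ Finset.range (m + 1), (m.choose i : ℝ) *
        SchwartzMap.seminorm ℝ 0 i χ * ‖iteratedFDeriv ℝ (m - i) φ x‖ := by
      rw [hψ']
      refine (norm_iteratedFDeriv_mul_le hχs (φ.smooth ⊤) x (by exact_mod_cast le_top)).trans
        (Finset.sum_le_sum fun i _ => ?_)
      gcongr
      rw [iteratedFDeriv_comp_const_smul ε (χ.smooth i), norm_smul, norm_pow,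
        Real.norm_of_nonneg hε.le]
      have := norm_iteratedFDeriv_le_seminorm ℝ χ i (ε • x)
      calc _ ≤ 1 * ‖iteratedFDeriv ℝ i χ (ε • x)‖ := by
            gcongr; exact pow_le_one₀ hε.le hε1
        _ ≤ _ := by rw [one_mul]; exact this
    rw [hsub, iteratedFDeriv_sub_apply (φ.smooth m).contDiffAt (ψ.smooth m).contDiffAt]
    calc ‖x‖ ^ k * ‖iteratedFDeriv ℝ m φ x - iteratedFDeriv ℝ m ψ x‖
        ≤ (ε * ‖x‖) * (‖x‖ ^ k * (‖iteratedFDeriv ℝ m φ x‖ +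
          ∑ i ∈ Finset.range (m + 1), (m.choose i : ℝ) *
            SchwartzMap.seminorm ℝ 0 i χ * ‖iteratedFDeriv ℝ (m - i) φ x‖)) := by
          refine le_trans ?_ (le_mul_of_one_le_left (mul_nonneg (by positivity)
            (add_nonneg (norm_nonneg _) ((norm_nonneg _).trans h1))) hx1)
          gcongr
          exact (norm_sub_le _ _).trans (by gcongr)
      _ = ε * (‖x‖ ^ (k + 1) * ‖iteratedFDeriv ℝ m φ x‖ +
          ∑ i ∈ Finset.range (m + 1), (m.choose i : ℝ) *
            SchwartzMap.seminorm ℝ 0 i χ *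
              (‖x‖ ^ (k + 1) * ‖iteratedFDeriv ℝ (m - i) φ x‖)) := by
          rw [mul_assoc, ← mul_assoc ‖x‖, ← pow_succ', mul_add, Finset.mul_sum]
          congr 3
          ext i
          ring
      _ ≤ ε * A := by
          rw [hA]
          refine mul_le_mul_of_nonneg_left (add_le_add (le_seminorm ℝ (k + 1) m φ x)
            (Finset.sum_le_sum fun i _ => mul_le_mul_of_nonneg_left ?_
              (mul_nonneg (by positivity) (apply_nonneg _ _)))) hε.le
          · exact le_seminorm ℝ (k + 1) (m - i) φ x

/-- A continuous functional on Schwartz space that vanishes on compactly supported functions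
is zero. -/
theorem eq_zero_of_hasCompactSupport [FiniteDimensional ℝ V] (D : 𝓢(V, ℂ) →L[ℂ] ℂ)
    (hD : ∀ φ : 𝓢(V, ℂ), HasCompactSupport φ → D φ = 0) (φ : 𝓢(V, ℂ)) : D φ = 0 := by
  have : HasContDiffBump V := inferInstance
  let b : ContDiffBump (0 : V) := ⟨1, 2, one_pos, one_lt_two⟩
  let χf : V → ℂ := fun x => (b x : ℂ)
  have hχc : HasCompactSupport χf := (show HasCompactSupport (b : V → ℝ) from b.hasCompactSupport).comp_left
    (g := Complex.ofReal) Complex.ofReal_zero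
  have hχs : ContDiff ℝ ∞ χf := Complex.ofRealCLM.contDiff.comp b.contDiff
  let χ : 𝓢(V, ℂ) := hχc.toSchwartzMap hχs
  have hχ : ∀ x, ‖x‖ ≤ 1 → χ x = 1 := fun x hx => by
    have : b x = 1 := b.one_of_mem_closedBall (by simpa [b] using hx)
    change (b x : ℂ) = 1
    rw [this]; rfl
  let e : ℕ → ℝ := fun n => 1 / ((n : ℝ) + 1)
  have he : ∀ n, 0 < e n := fun n => Nat.one_div_pos_of_nat
  have he1 : ∀ n, e n ≤ 1 := fun n => by
    rw [div_le_one (by positivity)]; linarith [Nat.cast_nonneg (α := ℝ) n]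
  have hc : ∀ n, HasCompactSupport fun x => χ (e n • x) * φ x := fun n => by
    have : HasCompactSupport fun x => χf (e n • x) :=
      hχc.comp_homeomorph (Homeomorph.smulOfNeZero (e n) (he n).ne')
    exact this.mul_right
  let ψ : ℕ → 𝓢(V, ℂ) := fun n => (hc n).toSchwartzMap
    (((χ.smooth ⊤).comp (contDiff_const_smul (e n))).mul (φ.smooth ⊤))
  have hψ : Filter.Tendsto ψ Filter.atTop (nhds φ) := by
    refine ((schwartz_withSeminorms ℝ V ℂ).tendsto_nhds _ _).2 fun p ε hε => ?_
    have ht := tendsto_one_div_add_atTop_nhds_zero_nat (𝕜 := ℝ).mul_const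
      (SchwartzMap.seminorm ℝ (p.1 + 1) p.2 φ +
        ∑ i ∈ Finset.range (p.2 + 1), (p.2.choose i : ℝ) *
        SchwartzMap.seminorm ℝ 0 i χ * SchwartzMap.seminorm ℝ (p.1 + 1) (p.2 - i) φ)
    rw [zero_mul] at ht
    filter_upwards [ht.eventually (gt_mem_nhds hε)] with n hn
    rw [map_sub_rev]
    exact (seminorm_sub_cutoff_le φ χ (ψ n) (he n) (he1 n) hχ (fun _ => rfl) p.1 p.2).trans_lt hn
  have h1 : Filter.Tendsto (fun n => D (ψ n)) Filter.atTop (nhds (D φ)) :=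
    (D.continuous.tendsto φ).comp hψ
  have h2 : (fun n => D (ψ n)) = fun _ => 0 := funext fun n => hD _ (hc n)
  rw [h2] at h1
  exact tendsto_nhds_unique h1 tendsto_const_nhds

end Cutoff

/-! ### Totality of modulated Gaussians -/

section Characters

theorem hasTemperateGrowth_inner_prod {V : Type*} [NormedAddCommGroup V] [InnerProductSpace ℝ V] :
    Function.HasTemperateGrowth (fun p : V × V => inner ℝ p.1 p.2) :=
  (innerSL ℝ (E := V)).bilinear_hasTemperateGrowth
    (ContinuousLinearMap.fst ℝ V V).hasTemperateGrowth
    (ContinuousLinearMap.snd ℝ V V).hasTemperateGrowth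

variable {V : Type*} [NormedAddCommGroup V] [InnerProductSpace ℝ V] [FiniteDimensional ℝ V]
  [MeasurableSpace V] [BorelSpace V]

/-- The modulated Gaussians are total in Schwartz space. -/
theorem eq_zero_of_modulated_gaussian {c : ℝ} (hc : 0 < c) (D : 𝓢(V, ℂ) →L[ℂ] ℂ)
    (hD : ∀ (β : V) (φ : 𝓢(V, ℂ)),
      (∀ v, φ v = Complex.exp (2 * Real.pi * Complex.I * (inner ℝ β v : ℂ)) *
        (Real.exp (-c * ‖v‖ ^ 2) : ℂ)) → D φ = 0) (φ : 𝓢(V, ℂ)) : D φ = 0 := by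
  have hmul : ∀ φ : 𝓢(V, ℂ), D (mulSchwartz (gaussianSchwartz V hc) φ) = 0 := fun φ => by
    have hg := (hasTemperateGrowth_inner_prod (V := V)).cexp_two_pi_I
    -- The slice of `Θ` at `β` is `φ̂(β)` times a modulated Gaussian, and by Fourier inversion its
    -- marginal over `β` is the Gaussian times `φ`.
    let Θ : 𝓢(V × V, ℂ) := smulLeftCLM ℂ
      (fun p : V × V => Complex.exp (2 * Real.pi * Complex.I * (inner ℝ p.1 p.2 : ℂ)))
      (tensor (𝓕 φ) (gaussianSchwartz V hc))
    have hΘ : ∀ β v, Θ (β, v) = Complex.exp (2 * Real.pi * Complex.I * (inner ℝ β v : ℂ)) *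
        (𝓕 φ β * (Real.exp (-c * ‖v‖ ^ 2) : ℂ)) := fun β v => by
      simp only [Θ]
      rw [smulLeftCLM_apply_apply hg]
      simp [-Complex.ofReal_exp]
    refine apply_marginal_eq_zero (μ := volume) D (f := Θ) (fun v => ?_) fun β => ?_
    · simp_rw [hΘ]
      rw [mulSchwartz_apply, gaussianSchwartz_apply]
      have h1 : φ v = (𝓕⁻ (𝓕 φ : 𝓢(V, ℂ)) : 𝓢(V, ℂ)) v := by
        rw [FourierTransform.fourierInv_fourier_eq]
      rw [h1, fourierInv_coe, Real.fourierInv_eq', ← integral_const_mul]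
      refine integral_congr_ae (Filter.Eventually.of_forall fun β => ?_)
      simp only [smul_eq_mul]
      have : ((2 * Real.pi * inner ℝ β v : ℝ) : ℂ) * Complex.I =
        2 * Real.pi * Complex.I * (inner ℝ β v : ℂ) := by push_cast; ring
      rw [this]
      ring
    · have hβ : Function.HasTemperateGrowth (fun v : V => (inner ℝ β v : ℝ)) := by fun_prop
      let φβ : 𝓢(V, ℂ) := smulLeftCLM ℂ
        (fun v : V => Complex.exp (2 * Real.pi * Complex.I * (inner ℝ β v : ℂ)))
        (gaussianSchwartz V hc)
      have hφβ : ∀ v, φβ v = Complex.exp (2 * Real.pi * Complex.I * (inner ℝ β v : ℂ)) *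
          (Real.exp (-c * ‖v‖ ^ 2) : ℂ) := fun v => by
        simp only [φβ]
        rw [smulLeftCLM_apply_apply hβ.cexp_two_pi_I]
        simp [-Complex.ofReal_exp]
      have : slice Θ β = (𝓕 φ β) • φβ := by
        ext v
        rw [slice_apply, hΘ, smul_apply, hφβ, smul_eq_mul]
        ring
      rw [this, map_smul, hD β φβ hφβ, smul_zero]
  -- For compactly supported `φ` the quotient of `φ` by the Gaussian, written as the "Gaussian" of
  -- parameter `-c` times `φ`, is again a test function.
  refine eq_zero_of_hasCompactSupport D (fun φ hφ => ?_) φ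
  have hq : ContDiff ℝ ∞ fun x => (Real.exp (- (-c) * ‖x‖ ^ 2) : ℂ) * φ x :=
    (contDiff_gaussian (-c)).mul (φ.smooth ⊤)
  have hqc : HasCompactSupport fun x => (Real.exp (- (-c) * ‖x‖ ^ 2) : ℂ) * φ x := hφ.mul_left
  rw [← hmul (hqc.toSchwartzMap hq)]
  congr 1
  ext x
  rw [mulSchwartz_apply, gaussianSchwartz_apply]
  change φ x = _ * (_ * φ x)
  rw [← mul_assoc, ← Complex.ofReal_mul, ← Real.exp_add]
  simp

end Characters

end SchwartzMap

namespace WignerFIO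

/-! ### Multi-indices of order two -/

section MultiIndex

/-- The multinomial theorem of degree two, read off coefficient by coefficient. -/
theorem sum_piAntidiag_two {ι : Type*} [Fintype ι] [DecidableEq ι] (u : ι → ℝ)
    (G : (ι → ℕ) → ℝ) :
    ∑ α ∈ Finset.piAntidiag (Finset.univ : Finset ι) 2,
      (Nat.multinomial Finset.univ α : ℝ) * ((∏ i, u i ^ α i) * G α) =
      ∑ i, ∑ j, u i * u j * G (Pi.single i 1 + Pi.single j 1) := by
  -- `L` replaces each monomial of exponent `m` by the number `G m`. Applied to the two expansions
  -- of `(∑ uᵢXᵢ)²`, as a sum over multi-indices and as a double sum, it gives the identity.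
  let L : MvPolynomial ι ℝ →ₗ[ℝ] ℝ :=
    (MvPolynomial.basisMonomials ι ℝ).constr ℝ (fun m => G m)
  have hL : ∀ m c, L (MvPolynomial.monomial m c) = c * G m := fun m c => by
    have : MvPolynomial.monomial m c = c • MvPolynomial.basisMonomials ι ℝ m := by
      simp [MvPolynomial.smul_monomial]
    rw [this, map_smul, (MvPolynomial.basisMonomials ι ℝ).constr_basis, smul_eq_mul]
  let X : ι → MvPolynomial ι ℝ := fun i => MvPolynomial.monomial (Finsupp.single i 1) (u i)
  have h1 := congrArg L (Finset.sum_pow_eq_sum_piAntidiag Finset.univ X 2)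
  rw [sq, Finset.sum_mul_sum, map_sum, map_sum] at h1
  refine (Finset.sum_congr rfl fun α _ => ?_).trans
    (h1.symm.trans (Finset.sum_congr rfl fun i _ => ?_))
  · have : ∏ i, X i ^ α i =
        MvPolynomial.monomial (Finsupp.equivFunOnFinite.symm α) (∏ i, u i ^ α i) := by
      have hs : ∀ s : Finset ι, ∏ i ∈ s, X i ^ α i =
          MvPolynomial.monomial (∑ i ∈ s, Finsupp.single i (α i)) (∏ i ∈ s, u i ^ α i) :=
        fun s => by
          induction s using Finset.induction_on with
          | empty => simp
          | insert i s hi ih =>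
            rw [Finset.prod_insert hi, Finset.prod_insert hi, Finset.sum_insert hi, ih]
            simp only [X, MvPolynomial.monomial_pow, MvPolynomial.monomial_mul,
              Finsupp.smul_single, smul_eq_mul, mul_one]
      rw [hs]
      have : ∑ i, Finsupp.single i (α i) = Finsupp.equivFunOnFinite.symm α := by
        ext i
        simp [Finsupp.finsetSum_apply, Finsupp.single_apply]
      rw [this]
    rw [this, ← nsmul_eq_mul (α := MvPolynomial ι ℝ), LinearMap.map_smul_of_tower L, hL,
      nsmul_eq_mul]
    rfl
  · rw [map_sum]
    refine Finset.sum_congr rfl fun j _ => ?_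
    simp only [X, MvPolynomial.monomial_mul]
    rw [hL]
    congr 2
    ext k
    simp [Finsupp.single_apply, Pi.single_apply, eq_comm]

end MultiIndex

/-! ### Taylor's formula with integral remainder -/

section Taylor

variable {E : Type*} [NormedAddCommGroup E] [NormedSpace ℝ E]

theorem fderiv_fderiv_comm {f : E → ℝ} (hf : ContDiff ℝ ∞ f) (v w : E) (z : E) :
    fderiv ℝ (fun y => fderiv ℝ f y w) z v = fderiv ℝ (fun y => fderiv ℝ f y v) z w := by
  have hd : Differentiable ℝ (fderiv ℝ f) :=
    (hf.fderiv_right (m := ∞) (by simp)).differentiable (by simp)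
  have h : ∀ v w, fderiv ℝ (fun y => fderiv ℝ f y w) z v = fderiv ℝ (fderiv ℝ f) z v w :=
    fun v w => by
      rw [((hd z).hasFDerivAt.clm_apply (hasFDerivAt_const w z)).fderiv]
      simp
  rw [h, h]
  exact ((by simpa using contDiff_infty.1 hf 2 : ContDiff ℝ 2 f).contDiffAt.isSymmSndFDerivAt (by simp)) _ _

theorem integral_taylor_remainder {Φ : E → ℝ} (hΦ : ContDiff ℝ ∞ Φ) (z u : E) :
    ∫ τ in (0 : ℝ)..1, (1 - τ) * fderiv ℝ (fun p => fderiv ℝ Φ p u) (z + (τ / 2) • u) u =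
      4 * Φ (z + (1 / 2 : ℝ) • u) - (2 * fderiv ℝ Φ z u + 4 * Φ z) := by
  let c : ℝ → E := fun τ => z + (τ / 2) • u
  have hc : ∀ τ, HasDerivAt c ((1 / 2 : ℝ) • u) τ := fun τ => by
    have := (((hasDerivAt_id τ).div_const 2).smul_const u).const_add z
    simpa [c] using this
  have hcc : Continuous c := by fun_prop
  let D1 : E → ℝ := fun p => fderiv ℝ Φ p u
  have hD1 : ContDiff ℝ ∞ D1 := (hΦ.fderiv_right (m := ∞) (by simp)).clm_apply contDiff_const
  let D2 : E → ℝ := fun p => fderiv ℝ D1 p u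
  have hD2 : ContDiff ℝ ∞ D2 := (hD1.fderiv_right (m := ∞) (by simp)).clm_apply contDiff_const
  have hg : ∀ τ, HasDerivAt (fun τ => Φ (c τ)) ((1 / 2) * D1 (c τ)) τ := fun τ => by
    have := ((hΦ.differentiable (by simp)) (c τ)).hasFDerivAt.comp_hasDerivAt τ (hc τ)
    rw [map_smul, smul_eq_mul] at this
    exact this
  have hg1 : ∀ τ, HasDerivAt (fun τ => D1 (c τ)) ((1 / 2) * D2 (c τ)) τ := fun τ => by
    have := ((hD1.differentiable (by simp)) (c τ)).hasFDerivAt.comp_hasDerivAt τ (hc τ)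
    rw [map_smul, smul_eq_mul] at this
    exact this
  have h3 : ∫ τ in (0 : ℝ)..1, (1 - τ) * D2 (c τ) =
      4 * Φ (c 1) - (2 * D1 (c 0) + 4 * Φ (c 0)) := by
    -- The antiderivative comes from integrating by parts along the segment. Each derivative in `τ`
    -- brings a factor 1/2 because the increment is `u / 2`, whence the coefficients 2 and 4.
    have := intervalIntegral.integral_eq_sub_of_hasDerivAt (a := 0) (b := 1)
      (f := fun τ => 2 * ((1 - τ) * D1 (c τ)) + 4 * Φ (c τ))
      (f' := fun τ => (1 - τ) * D2 (c τ)) (fun τ _ => by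
        have h := ((((hasDerivAt_id τ).const_sub 1).mul (hg1 τ)).const_mul 2).add
          ((hg τ).const_mul 4)
        have e : 2 * (-1 * D1 (c τ) + (1 - id τ) * (1 / 2 * D2 (c τ))) +
            4 * (1 / 2 * D1 (c τ)) = (1 - τ) * D2 (c τ) := by rw [id]; ring
        rw [e] at h
        exact h) (Continuous.intervalIntegrable (by
          have := hD2.continuous
          fun_prop) _ _)
    rw [this]
    ring
  have c0 : c 0 = z := by simp [c]
  rw [c0] at h3
  exact h3

end Taylor

/-! ### The Taylor remainders and the gradients of the phase -/

section Derivatives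

variable {d : ℕ}

theorem contDiff_pderiv {f : Phase d → ℝ} (hf : ContDiff ℝ ∞ f) (i : Fin d ⊕ Fin d) :
    ContDiff ℝ ∞ (pderiv i f) :=
  (hf.fderiv_right (m := ∞) (by simp)).clm_apply contDiff_const

theorem pderiv_comm {f : Phase d → ℝ} (hf : ContDiff ℝ ∞ f) (i j : Fin d ⊕ Fin d) :
    pderiv i (pderiv j f) = pderiv j (pderiv i f) :=
  funext fun z => fderiv_fderiv_comm hf (coordVec i) (coordVec j) z

theorem contDiff_iterate_pderiv {f : Phase d → ℝ} (hf : ContDiff ℝ ∞ f) (i : Fin d ⊕ Fin d)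
    (n : ℕ) : ContDiff ℝ ∞ ((pderiv i)^[n] f) := by
  induction n with
  | zero => exact hf
  | succ n ih => rw [Function.iterate_succ_apply']; exact contDiff_pderiv ih i

theorem iterate_pderiv_comm {f : Phase d → ℝ} (hf : ContDiff ℝ ∞ f) (i j : Fin d ⊕ Fin d)
    (n : ℕ) : (pderiv j)^[n] (pderiv i f) = pderiv i ((pderiv j)^[n] f) := by
  induction n with
  | zero => rfl
  | succ n ih =>
    rw [Function.iterate_succ_apply', ih, Function.iterate_succ_apply',
      pderiv_comm (contDiff_iterate_pderiv hf j n)]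

/-- The derivative `∂^α f` restricted to the coordinates in the list `l`. -/
def listDeriv (l : List (Fin d ⊕ Fin d)) (α : Fin d ⊕ Fin d → ℕ) (f : Phase d → ℝ) :
    Phase d → ℝ :=
  l.foldr (fun i g => (pderiv i)^[α i] g) f

theorem contDiff_listDeriv (l : List (Fin d ⊕ Fin d)) (α : Fin d ⊕ Fin d → ℕ)
    {f : Phase d → ℝ} (hf : ContDiff ℝ ∞ f) : ContDiff ℝ ∞ (listDeriv l α f) := by
  induction l with
  | nil => exact hf
  | cons i l ih => exact contDiff_iterate_pderiv ih i _

/-- The extra derivative enters at the place of `i` in the list and moves to the front by symmetry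
of mixed derivatives. Both cases run through one induction: once `i` is met, it must be absent from
the tail, as `Nodup` guarantees. -/
theorem listDeriv_add_single (l : List (Fin d ⊕ Fin d)) (hl : l.Nodup)
    (α : Fin d ⊕ Fin d → ℕ) (i : Fin d ⊕ Fin d) {f : Phase d → ℝ} (hf : ContDiff ℝ ∞ f) :
    (i ∈ l → listDeriv l (α + Pi.single i 1) f = pderiv i (listDeriv l α f)) ∧
      (i ∉ l → listDeriv l (α + Pi.single i 1) f = listDeriv l α f) := by
  induction l with
  | nil => simp [listDeriv]
  | cons j l ih =>
    have hcons : ∀ β, listDeriv (j :: l) β f = (pderiv j)^[β j] (listDeriv l β f) :=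
      fun _ => rfl
    rw [List.nodup_cons] at hl
    rw [hcons, hcons]
    by_cases hij : i = j
    · subst hij
      rw [(ih hl.2).2 hl.1, Pi.add_apply, Pi.single_eq_same, Function.iterate_succ_apply']
      simp
    · have : (α + Pi.single i 1 : Fin d ⊕ Fin d → ℕ) j = α j := by simp [Ne.symm hij]
      rw [this]
      refine ⟨fun h => ?_, fun h => ?_⟩
      · rw [(ih hl.2).1 (by simpa [hij] using h),
          iterate_pderiv_comm (contDiff_listDeriv l α hf)]
      · rw [(ih hl.2).2 (by simp_all)]

theorem multiDeriv_add_single (α : Fin d ⊕ Fin d → ℕ) (i : Fin d ⊕ Fin d) {f : Phase d → ℝ}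
    (hf : ContDiff ℝ ∞ f) : multiDeriv (α + Pi.single i 1) f = pderiv i (multiDeriv α f) := by
  have hl : ((List.finRange d).map Sum.inl ++ (List.finRange d).map Sum.inr :
      List (Fin d ⊕ Fin d)).Nodup := by
    refine List.Nodup.append ((List.nodup_finRange d).map Sum.inl_injective)
      ((List.nodup_finRange d).map Sum.inr_injective) fun x hx hy => ?_
    simp only [List.mem_map] at hx hy
    obtain ⟨a, -, rfl⟩ := hx
    obtain ⟨b, -, hb⟩ := hy
    cases hb
  exact (listDeriv_add_single _ hl α i hf).1 (by cases i <;> simp)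

theorem multiDeriv_zero (f : Phase d → ℝ) : multiDeriv 0 f = f := by
  have : ∀ l : List (Fin d ⊕ Fin d), l.foldr (fun i g => (pderiv i)^[0] g) f = f := fun l => by
    induction l with
    | nil => rfl
    | cons i l ih => exact ih
  exact this _

theorem multiDeriv_single_add_single (i j : Fin d ⊕ Fin d) {f : Phase d → ℝ}
    (hf : ContDiff ℝ ∞ f) :
    multiDeriv (Pi.single i 1 + Pi.single j 1) f = pderiv j (pderiv i f) := by
  rw [multiDeriv_add_single _ _ hf, ← zero_add (Pi.single i 1), multiDeriv_add_single _ _ hf,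
    multiDeriv_zero]

theorem sum_coord_smul_coordVec (u : Phase d) : ∑ i, coord u i • coordVec i = u := by
  rw [Fintype.sum_sum_type]
  have h : ∀ x : Rd d, ∑ i, x i • EuclideanSpace.single i (1 : ℝ) = x := fun x => by
    ext j
    simp [Finset.sum_apply, Pi.single_apply]
  refine WithLp.ofLp_injective 2 (Prod.ext ?_ ?_)
  · simp [coord, coordVec, pt, Prod.fst_sum, h]
  · simp [coord, coordVec, pt, Prod.snd_sum, h]

theorem sum_coord_mul_pderiv (f : Phase d → ℝ) (z u : Phase d) :
    ∑ i, coord u i * pderiv i f z = fderiv ℝ f z u := by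
  conv_rhs => rw [← sum_coord_smul_coordVec u, map_sum]
  simp [pderiv]

theorem sum_coord_mul_pderiv_pderiv {Φ : Phase d → ℝ} (hΦ : ContDiff ℝ ∞ Φ) (u p : Phase d) :
    ∑ i, ∑ j, coord u i * coord u j * pderiv j (pderiv i Φ) p =
      fderiv ℝ (fun p => fderiv ℝ Φ p u) p u := by
  have e1 : (fun p => fderiv ℝ Φ p u) = fun q => ∑ i, coord u i * pderiv i Φ q :=
    funext fun q => (sum_coord_mul_pderiv Φ q u).symm
  have hd := fun i => (contDiff_pderiv hΦ i).differentiable (by simp) p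
  rw [e1, fderiv_fun_sum fun i _ => (hd i).const_mul _, sum_apply]
  refine Finset.sum_congr rfl fun i _ => ?_
  rw [fderiv_const_mul (hd i), smul_apply, ← sum_coord_mul_pderiv, smul_eq_mul, Finset.mul_sum]
  exact Finset.sum_congr rfl fun j _ => by ring

theorem taylorPlus_eq {Φ : Phase d → ℝ} (hΦ : ContDiff ℝ ∞ Φ) (z u : Phase d) :
    taylorPlus Φ z u = Φ (z + (1 / 2 : ℝ) • u) - Φ z - (1 / 2) * fderiv ℝ Φ z u := by
  let G : (Fin d ⊕ Fin d → ℕ) → ℝ := fun α =>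
    ∫ τ in (0 : ℝ)..1, (1 - τ) * multiDeriv α Φ (z + (τ / 2) • u)
  -- For `|α| = 2` the multinomial coefficient is `2/α!`, so the weight `1/(2α!)` is a quarter of
  -- it.
  have h1 : taylorPlus Φ z u = (1 / 4) * ∑ i, ∑ j, coord u i * coord u j *
      G (Pi.single i 1 + Pi.single j 1) := by
    rw [← sum_piAntidiag_two, taylorPlus, Finset.mul_sum]
    refine Finset.sum_congr rfl fun α hα => ?_
    have hs : ∑ i, α i = 2 := (Finset.mem_piAntidiag.1 hα).1
    have hm := Nat.multinomial_spec (Finset.univ : Finset (Fin d ⊕ Fin d)) α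
    rw [hs] at hm
    have hm' : (∏ i, ((α i).factorial : ℝ)) * (Nat.multinomial Finset.univ α : ℝ) = 2 := by
      exact_mod_cast hm
    have hp : (∏ i, ((α i).factorial : ℝ)) ≠ 0 :=
      Finset.prod_ne_zero_iff.2 fun i _ => by positivity
    have hmm : (Nat.multinomial Finset.univ α : ℝ) = 2 / ∏ i, ((α i).factorial : ℝ) := by
      rw [eq_div_iff hp, mul_comm, hm']
    rw [hmm]
    simp only [G]
    field_simp
    ring
  have h2 : ∑ i, ∑ j, coord u i * coord u j * G (Pi.single i 1 + Pi.single j 1) =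
      ∫ τ in (0 : ℝ)..1, (1 - τ) * fderiv ℝ (fun p => fderiv ℝ Φ p u) (z + (τ / 2) • u) u := by
    have hint : ∀ i j : Fin d ⊕ Fin d, IntervalIntegrable
        (fun τ : ℝ => coord u i * coord u j * ((1 - τ) * pderiv j (pderiv i Φ) (z + (τ / 2) • u)))
        volume 0 1 := fun i j => by
      have := (contDiff_pderiv (contDiff_pderiv hΦ i) j).continuous
      exact Continuous.intervalIntegrable (by fun_prop) _ _
    have e : (fun τ : ℝ => (1 - τ) * fderiv ℝ (fun p => fderiv ℝ Φ p u) (z + (τ / 2) • u) u) = fun τ : ℝ => ∑ i, ∑ j,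
        coord u i * coord u j * ((1 - τ) * pderiv j (pderiv i Φ) (z + (τ / 2) • u)) := by
      ext τ
      rw [← sum_coord_mul_pderiv_pderiv hΦ, Finset.mul_sum]
      refine Finset.sum_congr rfl fun i _ => ?_
      rw [Finset.mul_sum]
      exact Finset.sum_congr rfl fun j _ => by ring
    rw [e, intervalIntegral.integral_finsetSum fun i _ =>
      by
        have := IntervalIntegrable.sum Finset.univ fun j _ => hint i j
        rwa [Finset.sum_fn] at this]
    refine Finset.sum_congr rfl fun i _ => ?_
    rw [intervalIntegral.integral_finsetSum fun j _ => hint i j]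
    refine Finset.sum_congr rfl fun j _ => ?_
    rw [intervalIntegral.integral_const_mul]
    simp only [G]
    rw [multiDeriv_single_add_single i j hΦ]
  rw [h1, h2, integral_taylor_remainder hΦ]
  ring

theorem taylorMinus_eq {Φ : Phase d → ℝ} (hΦ : ContDiff ℝ ∞ Φ) (z u : Phase d) :
    taylorMinus Φ z u = Φ (z - (1 / 2 : ℝ) • u) - Φ z + (1 / 2) * fderiv ℝ Φ z u := by
  -- `u^α` is even in `u` because `|α| = 2`.
  have h : taylorMinus Φ z u = taylorPlus Φ z (-u) := by
    refine Finset.sum_congr rfl fun α hα => ?_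
    have hs : ∑ i, α i = 2 := (Finset.mem_piAntidiag.1 hα).1
    have hc : ∀ i, coord (-u) i = - coord u i := fun i => by cases i <;> simp [coord]
    have : ∏ i, coord (-u) i ^ α i = ∏ i, coord u i ^ α i := by
      simp_rw [hc, neg_pow (coord u _)]
      rw [Finset.prod_mul_distrib, Finset.prod_pow_eq_pow_sum, hs]
      simp
    simp only [this, smul_neg, ← sub_eq_add_neg]
  rw [h, taylorPlus_eq hΦ, smul_neg, ← sub_eq_add_neg, map_neg]
  ring

theorem taylorPlus_sub_taylorMinus {Φ : Phase d → ℝ} (hΦ : ContDiff ℝ ∞ Φ) (z u : Phase d) :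
    taylorPlus Φ z u - taylorMinus Φ z u =
      Φ (z + (1 / 2 : ℝ) • u) - Φ (z - (1 / 2 : ℝ) • u) - fderiv ℝ Φ z u := by
  rw [taylorPlus_eq hΦ, taylorMinus_eq hΦ]
  ring

theorem fderiv_eq_inner_grad {Φ : Phase d → ℝ} (hΦ : ContDiff ℝ ∞ Φ) (x η : Rd d)
    (u : Phase d) :
    fderiv ℝ Φ (pt x η) u = inner ℝ u.fst (gradX Φ x η) + inner ℝ u.snd (gradEta Φ x η) := by
  have hd := (hΦ.differentiable (by simp)) (pt x η)
  let e := (WithLp.prodContinuousLinearEquiv 2 ℝ (Rd d) (Rd d)).symm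
  have h1 : HasFDerivAt (fun x' => Φ (pt x' η)) ((fderiv ℝ Φ (pt x η)).comp
      ((e : (Rd d × Rd d) →L[ℝ] Phase d).comp (ContinuousLinearMap.inl ℝ (Rd d) (Rd d)))) x :=
    hd.hasFDerivAt.comp x ((e.hasFDerivAt).comp x (hasFDerivAt_prodMk_left x η))
  have h2 : HasFDerivAt (fun η' => Φ (pt x η')) ((fderiv ℝ Φ (pt x η)).comp
      ((e : (Rd d × Rd d) →L[ℝ] Phase d).comp (ContinuousLinearMap.inr ℝ (Rd d) (Rd d)))) η :=
    hd.hasFDerivAt.comp η ((e.hasFDerivAt).comp η (hasFDerivAt_prodMk_right x η))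
  have g1 : ∀ v, inner ℝ v (gradX Φ x η) = fderiv ℝ Φ (pt x η) (pt v 0) := fun v => by
    rw [real_inner_comm, gradX, gradient, InnerProductSpace.toDual_symm_apply, h1.fderiv]
    rfl
  have g2 : ∀ v, inner ℝ v (gradEta Φ x η) = fderiv ℝ Φ (pt x η) (pt 0 v) := fun v => by
    rw [real_inner_comm, gradEta, gradient, InnerProductSpace.toDual_symm_apply, h2.fderiv]
    rfl
  rw [g1, g2, ← map_add]
  congr 1
  refine WithLp.ofLp_injective 2 (Prod.ext ?_ ?_) <;> simp [pt]

end Derivatives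

end WignerFIO

/-! ### Midpoint coordinates -/

section Midpoint

variable {V : Type*} [NormedAddCommGroup V] [NormedSpace ℝ V]

/-- The change of variables `(z, u) ↦ (z + u / 2, z - u / 2)`. -/
def midpointEquiv (V : Type*) [NormedAddCommGroup V] [NormedSpace ℝ V] :
    (V × V) ≃L[ℝ] (V × V) :=
  ContinuousLinearEquiv.equivOfInverse
    ((ContinuousLinearMap.fst ℝ V V + (1 / 2 : ℝ) • ContinuousLinearMap.snd ℝ V V).prod
      (ContinuousLinearMap.fst ℝ V V - (1 / 2 : ℝ) • ContinuousLinearMap.snd ℝ V V))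
    (((1 / 2 : ℝ) • (ContinuousLinearMap.fst ℝ V V + ContinuousLinearMap.snd ℝ V V)).prod
      (ContinuousLinearMap.fst ℝ V V - ContinuousLinearMap.snd ℝ V V))
    (fun p => by ext <;> simp <;> module) (fun p => by ext <;> simp <;> module)

theorem midpointEquiv_apply (p : V × V) :
    midpointEquiv V p = (p.1 + (1 / 2 : ℝ) • p.2, p.1 - (1 / 2 : ℝ) • p.2) := rfl

/-- The map is a composition of swaps and two shears: `(z, u)` goes to `(z - u/2, u)`, and then `u`
is replaced by its sum with the first entry. -/
theorem measurePreserving_midpointEquiv [MeasurableSpace V] [BorelSpace V]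
    [SecondCountableTopology V] (μ : Measure V) [SFinite μ] [μ.IsAddLeftInvariant] :
    MeasurePreserving (midpointEquiv V) (μ.prod μ) (μ.prod μ) := by
  have h1 : MeasurePreserving (fun p : V × V => (p.1, p.2 - (1 / 2 : ℝ) • p.1))
      (μ.prod μ) (μ.prod μ) :=
    (MeasurePreserving.id μ).skew_product (g := fun u z => z - (1 / 2 : ℝ) • u)
      (by fun_prop) (Filter.Eventually.of_forall fun u => by
        simpa [sub_eq_neg_add] using map_add_left_eq_self μ (-((1 / 2 : ℝ) • u)))
  have h2 := Measure.measurePreserving_swap.comp ((measurePreserving_prod_add μ μ).comp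
    (Measure.measurePreserving_swap.comp
    (h1.comp (Measure.measurePreserving_swap (μ := μ) (ν := μ)))))
  convert h2 using 1
  ext p
  · simp [midpointEquiv_apply]
    module
  · simp [midpointEquiv_apply]

namespace SchwartzMap

/-- The Schwartz function `(z, u) ↦ f (z + u / 2) * conj (g (z - u / 2))`. -/
def midTensor (f g : 𝓢(V, ℂ)) : 𝓢(V × V, ℂ) :=
  compCLMOfContinuousLinearEquiv ℂ (midpointEquiv V) (tensor f (conjugate g))

theorem midTensor_apply (f g : 𝓢(V, ℂ)) (z u : V) :
    midTensor f g (z, u) = f (z + (1 / 2 : ℝ) • u) * conj (g (z - (1 / 2 : ℝ) • u)) := rfl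

end SchwartzMap

end Midpoint

namespace SchwartzMap

/-! ### Fourier transform in the second variable -/

section PartialFourier

variable {E V : Type*} [NormedAddCommGroup E] [NormedSpace ℝ E]
  [NormedAddCommGroup V] [InnerProductSpace ℝ V] [FiniteDimensional ℝ V]
  [MeasurableSpace V] [BorelSpace V]

/-- The Fourier transform in the second variable. -/
def partialFourier (f : 𝓢(E × V, ℂ)) (p : E × V) : ℂ := 𝓕 (slice f p.1) p.2

theorem partialFourier_eq (f : 𝓢(E × V, ℂ)) (p : E × V) :
    partialFourier f p =
      ∫ u, Complex.exp (-(2 * Real.pi * Complex.I * (inner ℝ u p.2 : ℂ))) * f (p.1, u) := by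
  rw [partialFourier, fourier_coe, Real.fourier_eq']
  refine integral_congr_ae (Filter.Eventually.of_forall fun u => ?_)
  simp only [smul_eq_mul, slice_apply]
  congr 2
  push_cast
  ring

/-- The slice depends continuously on the base point, and the Fourier transform is continuous from
Schwartz space to bounded continuous functions. Joint continuity is then continuity of evaluation.
-/
theorem continuous_partialFourier (f : 𝓢(E × V, ℂ)) : Continuous (partialFourier f) := by
  have h : Continuous fun x => toBoundedContinuousFunctionCLM ℂ V ℂ
      (fourierTransformCLM ℂ (slice f x)) :=
    (toBoundedContinuousFunctionCLM ℂ V ℂ).continuous.comp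
      ((fourierTransformCLM ℂ).continuous.comp (continuous_slice f))
  exact continuous_eval.comp ((h.comp continuous_fst).prodMk continuous_snd)

/-- Continuity of the Fourier transform bounds the decay in frequency by finitely many seminorms of
the slice, and these absorb any power of the base point. -/
theorem exists_pow_mul_partialFourier_le (f : 𝓢(E × V, ℂ)) (k l : ℕ) :
    ∃ C : ℝ, ∀ p, ‖p.1‖ ^ k * (‖p.2‖ ^ l * ‖partialFourier f p‖) ≤ C := by
  obtain ⟨s, C, -, hC⟩ := Seminorm.bound_of_continuous (schwartz_withSeminorms ℝ V ℂ)
    ((SchwartzMap.seminorm ℝ l 0).comp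
      ((fourierTransformCLM ℂ (V := V) (E := ℂ)).toLinearMap.restrictScalars ℝ)) (by
      exact ((schwartz_withSeminorms ℝ V ℂ).continuous_seminorm (l, 0)).comp
        (fourierTransformCLM ℂ (V := V) (E := ℂ)).continuous)
  refine ⟨C * ∑ q ∈ s, SchwartzMap.seminorm ℝ (k + q.1) q.2 f, fun p => ?_⟩
  have h1 : ‖p.2‖ ^ l * ‖partialFourier f p‖ ≤
      C * (s.sup (schwartzSeminormFamily ℝ V ℂ)) (slice f p.1) :=
    (norm_pow_mul_le_seminorm ℝ (𝓕 (slice f p.1)) l p.2).trans (hC (slice f p.1))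
  have h2 : (s.sup (schwartzSeminormFamily ℝ V ℂ)) (slice f p.1) ≤
      ∑ q ∈ s, SchwartzMap.seminorm ℝ q.1 q.2 (slice f p.1) := by
    refine Seminorm.finset_sup_apply_le (Finset.sum_nonneg fun q _ => apply_nonneg _ _)
      fun q hq => ?_
    exact Finset.single_le_sum (f := fun q : ℕ × ℕ => SchwartzMap.seminorm ℝ q.1 q.2 (slice f p.1))
      (fun q _ => apply_nonneg _ _) hq
  calc _ ≤ ‖p.1‖ ^ k * (C * ∑ q ∈ s, SchwartzMap.seminorm ℝ q.1 q.2 (slice f p.1)) := by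
        exact mul_le_mul_of_nonneg_left (h1.trans (mul_le_mul_of_nonneg_left h2 C.2))
          (by positivity)
    _ = C * ∑ q ∈ s, ‖p.1‖ ^ k * SchwartzMap.seminorm ℝ q.1 q.2 (slice f p.1) := by
        rw [← Finset.mul_sum]; ring
    _ ≤ _ := by
        gcongr with q _
        exact pow_mul_seminorm_slice_le f k q.1 q.2 p.1

theorem exists_norm_partialFourier_le (f : 𝓢(E × V, ℂ)) :
    ∃ C : ℝ, ∀ p, ‖partialFourier f p‖ ≤ C := by
  simpa using exists_pow_mul_partialFourier_le f 0 0

theorem integrable_partialFourier [MeasurableSpace E] [BorelSpace E]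
    [SecondCountableTopology E] (μ : Measure (E × V)) [μ.HasTemperateGrowth]
    (f : 𝓢(E × V, ℂ)) : Integrable (partialFourier f) μ := by
  obtain ⟨C₀, h₀⟩ := exists_norm_partialFourier_le f
  obtain ⟨C₁, h₁⟩ := exists_pow_mul_partialFourier_le f (0 + μ.integrablePower) 0
  obtain ⟨C₂, h₂⟩ := exists_pow_mul_partialFourier_le f 0 (0 + μ.integrablePower)
  have h := integrable_of_le_of_pow_mul_le (μ := μ) (k := 0) (f := partialFourier f)
    (C₁ := C₀) (C₂ := max C₁ C₂) h₀ (fun p => ?_)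
    (continuous_partialFourier f).aestronglyMeasurable
  · exact (integrable_norm_iff (continuous_partialFourier f).aestronglyMeasurable).1
      (by simpa using h)
  · rw [Prod.norm_def]
    rcases max_choice ‖p.1‖ ‖p.2‖ with h | h <;> rw [h]
    · exact le_max_of_le_left (by simpa using h₁ p)
    · exact le_max_of_le_right (by simpa using h₂ p)

theorem integrable_partialFourier_left [MeasurableSpace E] [BorelSpace E]
    [SecondCountableTopology E] (μ : Measure E) [μ.HasTemperateGrowth]
    (f : 𝓢(E × V, ℂ)) (v : V) : Integrable (fun x => partialFourier f (x, v)) μ := by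
  obtain ⟨C₀, h₀⟩ := exists_norm_partialFourier_le f
  obtain ⟨C₁, h₁⟩ := exists_pow_mul_partialFourier_le f (0 + μ.integrablePower) 0
  have hc : Continuous fun x => partialFourier f (x, v) :=
    (continuous_partialFourier f).comp (by fun_prop)
  have h := integrable_of_le_of_pow_mul_le (μ := μ) (k := 0)
    (f := fun x => partialFourier f (x, v))
    (C₁ := C₀) (C₂ := C₁) (fun x => h₀ _) (fun x => by simpa using h₁ (x, v))
    hc.aestronglyMeasurable
  exact (integrable_norm_iff hc.aestronglyMeasurable).1 (by simpa using h)

end PartialFourier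

/-! ### Powers of `1 - Δ` as Fourier multipliers -/

section OneSubLaplacian

variable {V : Type*} [NormedAddCommGroup V] [InnerProductSpace ℝ V] [FiniteDimensional ℝ V]

/-- The operator `1 - Δ` on Schwartz functions. -/
def oneSubLaplacian (f : 𝓢(V, ℂ)) : 𝓢(V, ℂ) := f - Laplacian.laplacian f

theorem coe_iterate_oneSubLaplacian (N : ℕ) (f : 𝓢(V, ℂ)) :
    ((oneSubLaplacian^[N] f : 𝓢(V, ℂ)) : V → ℂ) =
      (fun h : V → ℂ => fun u => h u - Laplacian.laplacian h u)^[N] f := by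
  induction N with
  | zero => rfl
  | succ N ih =>
    rw [Function.iterate_succ_apply', Function.iterate_succ_apply', ← ih]
    ext u
    rw [oneSubLaplacian, sub_apply, laplacian_apply]

variable [MeasurableSpace V] [BorelSpace V]

theorem fourier_laplacian_apply (f : 𝓢(V, ℂ)) (w : V) :
    𝓕 (Laplacian.laplacian f) w = -((2 * Real.pi) ^ 2 * ‖w‖ ^ 2 : ℝ) * 𝓕 f w := by
  have hg : Function.HasTemperateGrowth (fun x : V => ‖x‖ ^ 2) := by fun_prop
  rw [laplacian_eq_fourierMultiplierCLM, FourierTransform.fourier_smul,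
    fourierMultiplierCLM_apply, FourierTransform.fourier_fourierInv_eq, smul_apply,
    smulLeftCLM_apply_apply hg, smul_smul, Complex.real_smul]
  push_cast
  ring

theorem fourier_iterate_oneSubLaplacian (N : ℕ) (f : 𝓢(V, ℂ)) (w : V) :
    𝓕 (oneSubLaplacian^[N] f) w = ((1 + (2 * Real.pi) ^ 2 * ‖w‖ ^ 2 : ℝ) : ℂ) ^ N * 𝓕 f w := by
  induction N with
  | zero => simp
  | succ N ih =>
    rw [Function.iterate_succ_apply', oneSubLaplacian,
      ← fourierTransformCLM_apply (𝕜 := ℂ), map_sub, fourierTransformCLM_apply,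
      fourierTransformCLM_apply, sub_apply, fourier_laplacian_apply, ih]
    push_cast
    ring

end OneSubLaplacian

end SchwartzMap

/-! ### The Wigner kernel of an operator with Schwartz kernel -/

namespace WignerFIO

open SchwartzMap

/-- The character `s ↦ exp (-2πi s)`. -/
def osc (s : ℝ) : ℂ := Complex.exp (-(2 * Real.pi * Complex.I * (s : ℂ)))

theorem osc_add (s t : ℝ) : osc (s + t) = osc s * osc t := by
  rw [osc, osc, osc, ← Complex.exp_add]
  push_cast
  ring_nf

theorem conj_osc (s : ℝ) : conj (osc s) = osc (-s) := by
  rw [osc, osc, ← Complex.exp_conj]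
  simp [Complex.conj_ofNat]

theorem osc_eq (s : ℝ) : osc s = Complex.exp (2 * Real.pi * Complex.I * ((-s : ℝ) : ℂ)) := by
  rw [osc]
  push_cast
  ring_nf

@[simp] theorem norm_osc (s : ℝ) : ‖osc s‖ = 1 := by
  rw [osc_eq, norm_cexp_two_pi_I]

theorem continuous_osc : Continuous osc := by
  unfold osc
  fun_prop

theorem integrable_osc_mul {X : Type*} [MeasurableSpace X] {μ : Measure X} {f : X → ℂ}
    (hf : Integrable f μ) {s : X → ℝ} (hs : Measurable s) :
    Integrable (fun x => osc (s x) * f x) μ :=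
  hf.bdd_mul (c := 1) (continuous_osc.measurable.comp hs).aestronglyMeasurable
    (Filter.Eventually.of_forall fun x => by simp)

section General

variable {V : Type*} [NormedAddCommGroup V] [InnerProductSpace ℝ V] [FiniteDimensional ℝ V]
  [MeasurableSpace V] [BorelSpace V]

theorem fourier_eq_osc (f : V → ℂ) (w : V) : 𝓕 f w = ∫ v, osc (inner ℝ v w) * f v := by
  rw [Real.fourier_eq']
  refine integral_congr_ae (Filter.Eventually.of_forall fun u => ?_)
  simp only [smul_eq_mul, osc]
  congr 2
  push_cast
  ring

/-- The marginal identity for the cross-Wigner distribution, on the Fourier side. -/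
theorem integral_partialFourier_midTensor (f g : 𝓢(V, ℂ)) (η r : V) :
    ∫ y, osc (inner ℝ r y) * partialFourier (midTensor f g) (y, η) =
      𝓕 (f : V → ℂ) (η + (1 / 2 : ℝ) • r) *
        conj (𝓕 (g : V → ℂ) (η - (1 / 2 : ℝ) • r)) := by
  -- `G` is the integrand of the right side as a double integral in `(a, b)`. Under `a = y + t/2`,
  -- `b = y - t/2` its phase becomes `r·y + t·η`.
  let G : V × V → ℂ := fun p => (osc (inner ℝ p.1 (η + (1 / 2 : ℝ) • r)) * f p.1) *
    conj (osc (inner ℝ p.2 (η - (1 / 2 : ℝ) • r)) * g p.2)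
  have hG : ∀ p : V × V, G (midpointEquiv V p) =
      osc (inner ℝ r p.1 + inner ℝ p.2 η) * midTensor f g p := fun p => by
    obtain ⟨y, t⟩ := p
    simp only [G, midpointEquiv_apply, midTensor_apply, map_mul, conj_osc]
    have : osc (inner ℝ r y + inner ℝ t η) =
        osc (inner ℝ (y + (1 / 2 : ℝ) • t) (η + (1 / 2 : ℝ) • r)) *
          osc (-inner ℝ (y - (1 / 2 : ℝ) • t) (η - (1 / 2 : ℝ) • r)) := by
      rw [← osc_add]
      congr 1
      simp only [inner_add_left, inner_add_right, inner_sub_left, inner_sub_right,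
        real_inner_smul_left, real_inner_smul_right]
      rw [real_inner_comm y r]
      ring
    rw [this]
    ring
  have hint : Integrable (fun p : V × V =>
      osc (inner ℝ r p.1 + inner ℝ p.2 η) * midTensor f g p) (volume.prod volume) :=
    integrable_osc_mul (midTensor f g).integrable (by fun_prop)
  calc ∫ y, osc (inner ℝ r y) * partialFourier (midTensor f g) (y, η)
      = ∫ y, ∫ t, osc (inner ℝ r y + inner ℝ t η) * midTensor f g (y, t) := by
        refine integral_congr_ae (Filter.Eventually.of_forall fun y => ?_)
        simp only
        rw [partialFourier_eq, ← integral_const_mul]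
        refine integral_congr_ae (Filter.Eventually.of_forall fun t => ?_)
        simp only
        rw [osc_add]
        simp only [osc]
        ring
    _ = ∫ p, G (midpointEquiv V p) ∂(volume.prod volume) := by
        rw [← integral_prod _ hint]
        simp_rw [hG]
    _ = ∫ p, G p ∂(volume.prod volume) :=
        (measurePreserving_midpointEquiv volume).integral_comp
          (midpointEquiv V).toHomeomorph.measurableEmbedding G
    _ = _ := by
        rw [integral_prod_mul (fun a => osc (inner ℝ a (η + (1 / 2 : ℝ) • r)) * f a)
          (fun b => conj (osc (inner ℝ b (η - (1 / 2 : ℝ) • r)) * g b)), integral_conj,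
          fourier_eq_osc, fourier_eq_osc]

end General

theorem hasTemperateGrowth_volume_prod (V : Type*) [NormedAddCommGroup V]
    [InnerProductSpace ℝ V] [FiniteDimensional ℝ V] [MeasurableSpace V] [BorelSpace V] :
    ((volume : Measure V).prod (volume : Measure V)).HasTemperateGrowth := inferInstance

variable {d : ℕ}

instance : ((volume : Measure (Rd d)).prod (volume : Measure (Rd d))).HasTemperateGrowth :=
  hasTemperateGrowth_volume_prod (Rd d)

instance : (volume : Measure (Phase d × Phase d)).HasTemperateGrowth :=
  hasTemperateGrowth_volume_prod (Phase d)

theorem crossWigner_eq (f g : 𝓢(Rd d, ℂ)) (z : Phase d) :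
    crossWigner f g z = partialFourier (midTensor f g) (z.fst, z.snd) := by
  rw [partialFourier_eq]
  refine integral_congr_ae (Filter.Eventually.of_forall fun t => ?_)
  simp only [midTensor_apply]
  ring

theorem inner_pt (u : Phase d) (a b : Rd d) :
    inner ℝ u (pt a b) = inner ℝ u.fst a + inner ℝ u.snd b := by
  rw [WithLp.prod_inner_apply]
  rfl

theorem integral_phase (f : Phase d → ℂ) :
    ∫ u, f u = ∫ p : Rd d × Rd d, f (pt p.1 p.2) :=
  ((WithLp.volume_preserving_toLp (U := Rd d) (V := Rd d)).integral_comp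
    (MeasurableEquiv.toLp 2 (Rd d × Rd d)).measurableEmbedding f).symm

theorem integrable_phase {f : Phase d → ℂ} (hf : Integrable f) :
    Integrable fun p : Rd d × Rd d => f (pt p.1 p.2) :=
  (WithLp.volume_preserving_toLp (U := Rd d) (V := Rd d)).integrable_comp_of_integrable hf

/-- The operator `f ↦ ∫ H(·, ξ) f̂(ξ) dξ`. -/
def kernelOp (H : 𝓢(Phase d, ℂ)) (f : 𝓢(Rd d, ℂ)) (x : Rd d) : ℂ :=
  ∫ ξ : Rd d, H (pt x ξ) * 𝓕 (f : Rd d → ℂ) ξ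

/-- The Wigner kernel of `kernelOp H`. -/
def wignerKernel (H : 𝓢(Phase d, ℂ)) (p : Phase d × Phase d) : ℂ :=
  partialFourier (midTensor H H) (pt p.1.fst p.2.snd, pt p.1.snd p.2.fst)

theorem wignerKernel_eq (H : 𝓢(Phase d, ℂ)) (x ξ y η : Rd d) :
    wignerKernel H (pt x ξ, pt y η) = ∫ p : Rd d × Rd d,
      osc (inner ℝ p.1 ξ + inner ℝ p.2 y) * midTensor H H (pt x η, pt p.1 p.2) := by
  rw [wignerKernel, partialFourier_eq, integral_phase]
  refine integral_congr_ae (Filter.Eventually.of_forall fun p => ?_)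
  simp only [inner_pt]
  rfl

theorem continuous_pt : Continuous fun p : Rd d × Rd d => pt p.1 p.2 :=
  WithLp.prod_continuous_toLp 2 _ _

theorem continuous_wignerKernel (H : 𝓢(Phase d, ℂ)) : Continuous (wignerKernel H) := by
  have h1 : Continuous fun z : Phase d => z.fst :=
    continuous_fst.comp (WithLp.prod_continuous_ofLp 2 _ _)
  have h2 : Continuous fun z : Phase d => z.snd :=
    continuous_snd.comp (WithLp.prod_continuous_ofLp 2 _ _)
  refine (continuous_partialFourier _).comp (Continuous.prodMk ?_ ?_)
  · exact continuous_pt.comp ((h1.comp continuous_fst).prodMk (h2.comp continuous_snd))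
  · exact continuous_pt.comp ((h2.comp continuous_fst).prodMk (h1.comp continuous_snd))

theorem exists_norm_wignerKernel_le (H : 𝓢(Phase d, ℂ)) :
    ∃ C : ℝ, ∀ p, ‖wignerKernel H p‖ ≤ C := by
  obtain ⟨C, hC⟩ := exists_norm_partialFourier_le (midTensor H H)
  exact ⟨C, fun p => hC _⟩

theorem norm_fst_le_norm_pt (x ξ : Rd d) : ‖x‖ ≤ ‖pt x ξ‖ := by
  rw [pt, WithLp.prod_norm_eq_of_L2]
  exact Real.le_sqrt_of_sq_le (by simp)

/-- Schwartz decay of order `d + 1` in `‖(x, ξ)‖ ≥ ‖x‖` gives an integrable majorant in `x`, uniform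
in `ξ`. It serves both the `L²` bound and Fubini. -/
theorem exists_integrable_bound (H : 𝓢(Phase d, ℂ)) : ∃ h : Rd d → ℝ, Continuous h ∧
    Integrable h ∧ (∀ x, 0 ≤ h x) ∧ (∃ C, ∀ x, h x ≤ C) ∧ ∀ x ξ, ‖H (pt x ξ)‖ ≤ h x := by
  obtain ⟨C, hC0, hC⟩ := H.exists_norm_le_rpow (Module.finrank ℝ (Rd d) + 1)
  set r : ℝ := ((Module.finrank ℝ (Rd d) + 1 : ℕ) : ℝ) with hr
  refine ⟨fun x => C * (1 + ‖x‖) ^ (-r), ?_, ?_, fun x => by positivity, ⟨C, fun x => ?_⟩,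
    fun x ξ => (hC _).trans ?_⟩
  · exact continuous_const.mul (Continuous.rpow_const (by fun_prop) fun x =>
      Or.inl (by positivity))
  · exact (integrable_one_add_norm (by rw [hr]; push_cast; linarith)).const_mul C
  · exact mul_le_of_le_one_right hC0 (Real.rpow_le_one_of_one_le_of_nonpos (by simp)
      (neg_nonpos.2 (Nat.cast_nonneg _)))
  · refine mul_le_mul_of_nonneg_left ?_ hC0
    exact Real.rpow_le_rpow_of_nonpos (by positivity)
      (by linarith [norm_fst_le_norm_pt x ξ]) (neg_nonpos.2 (Nat.cast_nonneg _))

theorem continuous_slice_pt (H : 𝓢(Phase d, ℂ)) :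
    Continuous fun p : Rd d × Rd d => H (pt p.1 p.2) := H.continuous.comp continuous_pt

theorem memLp_kernelOp (H : 𝓢(Phase d, ℂ)) (f : 𝓢(Rd d, ℂ)) : MemLp (kernelOp H f) 2 := by
  obtain ⟨h, hc, hi, h0, ⟨C, hC⟩, hH⟩ := exists_integrable_bound H
  have hf : Integrable (𝓕 (f : Rd d → ℂ)) := by
    rw [← fourier_coe]; exact (𝓕 f).integrable
  have hfc : Continuous (𝓕 (f : Rd d → ℂ)) := by
    rw [← fourier_coe]; exact (𝓕 f).continuous
  have hcont : Continuous (kernelOp H f) := by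
    refine continuous_of_dominated (bound := fun ξ => C * ‖𝓕 (f : Rd d → ℂ) ξ‖) (fun x => ?_)
      (fun x => Filter.Eventually.of_forall fun ξ => ?_) (hf.norm.const_mul C)
      (Filter.Eventually.of_forall fun ξ => ?_)
    · exact (((continuous_slice_pt H).comp (by fun_prop : Continuous fun ξ : Rd d => (x, ξ))).mul
        hfc).aestronglyMeasurable
    · rw [norm_mul]
      gcongr
      exact (hH x ξ).trans (hC x)
    · exact ((continuous_slice_pt H).comp
        (by fun_prop : Continuous fun x : Rd d => (x, ξ))).mul continuous_const
  have hb : ∀ x, ‖kernelOp H f x‖ ≤ h x * ∫ ξ, ‖𝓕 (f : Rd d → ℂ) ξ‖ := fun x => by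
    rw [← integral_const_mul]
    refine norm_integral_le_of_norm_le (hf.norm.const_mul _)
      (Filter.Eventually.of_forall fun ξ => ?_)
    rw [norm_mul]
    gcongr
    exact hH x ξ
  have hh : MemLp h 2 := by
    refine (memLp_two_iff_integrable_sq hc.aestronglyMeasurable).2 ?_
    simp_rw [sq]
    exact hi.bdd_mul (c := C) hc.aestronglyMeasurable (Filter.Eventually.of_forall fun x => by
      rw [Real.norm_of_nonneg (h0 x)]; exact hC x)
  exact (hh.mul_const (∫ ξ, ‖𝓕 (f : Rd d → ℂ) ξ‖)).of_le hcont.aestronglyMeasurable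
    (Filter.Eventually.of_forall fun x => (hb x).trans (le_abs_self _))

/-- Expanding the left side gives an integral over `t` and two frequencies. In midpoint coordinates
`(η, r)` the marginal identity replaces the product of Fourier transforms by an integral of
`W(f,g)(y, η)`. The remaining integral over `(t, r)` is the kernel. -/
theorem crossWigner_kernelOp (H : 𝓢(Phase d, ℂ)) (f g : 𝓢(Rd d, ℂ)) (x ξ : Rd d) :
    crossWigner (kernelOp H f) (kernelOp H g) (pt x ξ) =
      ∫ w, wignerKernel H (pt x ξ, w) * crossWigner f g w := by
  obtain ⟨h, hc, hi, h0, ⟨C, hC⟩, hH⟩ := exists_integrable_bound H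
  have hFi : ∀ f : 𝓢(Rd d, ℂ), Integrable (𝓕 (f : Rd d → ℂ)) := fun f => by
    rw [← fourier_coe]; exact (𝓕 f).integrable
  have hFc : ∀ f : 𝓢(Rd d, ℂ), Continuous (𝓕 (f : Rd d → ℂ)) := fun f => by
    rw [← fourier_coe]; exact (𝓕 f).continuous
  let R : Rd d → Rd d × Rd d → ℂ := fun t p => osc (inner ℝ t ξ) *
    ((H (pt (x + (1 / 2 : ℝ) • t) p.1) * 𝓕 (f : Rd d → ℂ) p.1) *
      conj (H (pt (x - (1 / 2 : ℝ) • t) p.2) * 𝓕 (g : Rd d → ℂ) p.2))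
  have hRc : Continuous (Function.uncurry R) := by
    have h1 : Continuous fun q : Rd d × Rd d × Rd d => H (pt (x + (1 / 2 : ℝ) • q.1) q.2.1) :=
      (continuous_slice_pt H).comp (by fun_prop :
        Continuous fun q : Rd d × Rd d × Rd d => (x + (1 / 2 : ℝ) • q.1, q.2.1))
    have h2 : Continuous fun q : Rd d × Rd d × Rd d => H (pt (x - (1 / 2 : ℝ) • q.1) q.2.2) :=
      (continuous_slice_pt H).comp (by fun_prop :
        Continuous fun q : Rd d × Rd d × Rd d => (x - (1 / 2 : ℝ) • q.1, q.2.2))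
    have h3 : Continuous fun q : Rd d × Rd d × Rd d => osc (inner ℝ q.1 ξ) :=
      continuous_osc.comp (by fun_prop)
    have h4 := (hFc f).comp (by fun_prop : Continuous fun q : Rd d × Rd d × Rd d => q.2.1)
    have h5 := (hFc g).comp (by fun_prop : Continuous fun q : Rd d × Rd d × Rd d => q.2.2)
    exact h3.mul ((h1.mul h4).mul (Complex.continuous_conj.comp (h2.mul h5)))
  have hRi : Integrable (Function.uncurry R) (volume.prod (volume.prod volume)) := by
    -- Only one of the two factors `H` is needed for integrability in `t`; the other is bounded by
    -- `C`.
    have hb : Integrable (fun q : Rd d × Rd d × Rd d => h (x + (1 / 2 : ℝ) • q.1) *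
        (‖𝓕 (f : Rd d → ℂ) q.2.1‖ * (C * ‖𝓕 (g : Rd d → ℂ) q.2.2‖)))
        (volume.prod (volume.prod volume)) :=
      ((hi.comp_add_left x).comp_smul (by norm_num : (1 / 2 : ℝ) ≠ 0)).mul_prod
        ((hFi f).norm.mul_prod ((hFi g).norm.const_mul C))
    refine hb.mono' hRc.aestronglyMeasurable (Filter.Eventually.of_forall fun q => ?_)
    simp only [Function.uncurry, R, norm_mul, norm_osc, one_mul, RCLike.norm_conj]
    rw [mul_assoc]
    gcongr
    · exact h0 _
    · exact hH _ _
    · exact (hH _ _).trans (hC _)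
  have hW : Integrable (fun w : Phase d => wignerKernel H (pt x ξ, w) * crossWigner f g w) := by
    obtain ⟨K, hK⟩ := exists_norm_wignerKernel_le H
    have h1 : Integrable (fun w : Phase d => crossWigner f g w) := by
      simp_rw [crossWigner_eq]
      exact (WithLp.volume_preserving_ofLp (U := Rd d) (V := Rd d)).integrable_comp_of_integrable
        (integrable_partialFourier ((volume : Measure (Rd d)).prod volume) (midTensor f g))
    exact h1.bdd_mul (c := K) ((continuous_wignerKernel H).comp
      (by fun_prop)).aestronglyMeasurable (Filter.Eventually.of_forall fun w => hK _)
  -- For fixed `η`, both sides are iterated integrals of one function of `y` and `p = (t, r)`.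
  -- Integrating `y` first gives `R` by the marginal identity; integrating `p` first gives the
  -- kernel.
  have key : ∀ η : Rd d, ∫ r, ∫ t, R t (midpointEquiv (Rd d) (η, r)) =
      ∫ y, wignerKernel H (pt x ξ, pt y η) * crossWigner f g (pt y η) := fun η => by
    let b : Rd d × Rd d → ℂ := fun p => midTensor H H (pt x η, pt p.1 p.2)
    have hb : Integrable b := integrable_phase (slice (midTensor H H) (pt x η)).integrable
    let W : Rd d → ℂ := fun y => partialFourier (midTensor f g) (y, η)
    have hWi : Integrable W := integrable_partialFourier_left volume (midTensor f g) η
    have hQ : Integrable (fun q : Rd d × (Rd d × Rd d) =>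
        osc (inner ℝ q.2.1 ξ + inner ℝ q.2.2 q.1) * (W q.1 * b q.2)) (volume.prod volume) :=
      integrable_osc_mul (hWi.mul_prod hb) (by fun_prop)
    have hP : ∀ p : Rd d × Rd d, ∫ y, osc (inner ℝ p.1 ξ + inner ℝ p.2 y) * (W y * b p) =
        R p.1 (midpointEquiv (Rd d) (η, p.2)) := fun p => by
      have e : ∀ y, osc (inner ℝ p.1 ξ + inner ℝ p.2 y) * (W y * b p) =
          osc (inner ℝ p.1 ξ) * b p * (osc (inner ℝ p.2 y) * W y) := fun y => by
        rw [osc_add]; ring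
      simp_rw [e]
      rw [integral_const_mul, integral_partialFourier_midTensor]
      simp only [R, b, midpointEquiv_apply, midTensor_apply, map_mul]
      have e1 : pt x η + (1 / 2 : ℝ) • pt p.1 p.2 =
          pt (x + (1 / 2 : ℝ) • p.1) (η + (1 / 2 : ℝ) • p.2) := rfl
      have e2 : pt x η - (1 / 2 : ℝ) • pt p.1 p.2 =
          pt (x - (1 / 2 : ℝ) • p.1) (η - (1 / 2 : ℝ) • p.2) := rfl
      rw [e1, e2]
      ring
    have hRp : Integrable (fun p : Rd d × Rd d => R p.1 (midpointEquiv (Rd d) (η, p.2)))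
        (volume.prod volume) := by
      have := hQ.integral_prod_right
      simp_rw [hP] at this
      exact this
    rw [← integral_prod_symm _ hRp]
    simp_rw [← hP]
    refine (integral_integral_swap (f := fun (y : Rd d) (p : Rd d × Rd d) =>
      osc (inner ℝ p.1 ξ + inner ℝ p.2 y) * (W y * b p)) hQ).symm.trans ?_
    refine integral_congr_ae (Filter.Eventually.of_forall fun y => ?_)
    simp only
    rw [wignerKernel_eq, crossWigner_eq, ← integral_mul_const]
    refine integral_congr_ae (Filter.Eventually.of_forall fun p => ?_)
    simp only [W, b]
    change _ = _ * partialFourier (midTensor f g) (y, η)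
    ring
  have hmp := measurePreserving_midpointEquiv (V := Rd d) volume
  have hemb := (midpointEquiv (Rd d)).toHomeomorph.measurableEmbedding
  calc crossWigner (kernelOp H f) (kernelOp H g) (pt x ξ)
      = ∫ t, ∫ p, R t p ∂(volume.prod volume) := by
        refine integral_congr_ae (Filter.Eventually.of_forall fun t => ?_)
        simp only [R]
        rw [integral_const_mul, integral_prod_mul
          (fun a => H (pt (x + (1 / 2 : ℝ) • t) a) * 𝓕 (f : Rd d → ℂ) a)
          (fun b => conj (H (pt (x - (1 / 2 : ℝ) • t) b) * 𝓕 (g : Rd d → ℂ) b)),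
          integral_conj, mul_comm]
        rfl
    _ = ∫ p, ∫ t, R t p ∂volume ∂(volume.prod volume) := integral_integral_swap hRi
    _ = ∫ p, ∫ t, R t (midpointEquiv (Rd d) p) ∂volume ∂(volume.prod volume) :=
        (hmp.integral_comp hemb (fun p => ∫ t, R t p)).symm
    _ = ∫ η, ∫ r, ∫ t, R t (midpointEquiv (Rd d) (η, r)) :=
        integral_prod _ (hmp.integrable_comp_of_integrable hRi.integral_prod_right)
    _ = ∫ η, ∫ y, wignerKernel H (pt x ξ, pt y η) * crossWigner f g (pt y η) := by
        simp_rw [key]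
    _ = _ := by
        rw [integral_phase]
        exact (integral_prod_symm _ (integrable_phase hW)).symm

end WignerFIO

/-! ### The kernel of the Fourier integral operator -/

namespace WignerFIO

open SchwartzMap

variable {d : ℕ}

theorem exists_distribution {k : Phase d × Phase d → ℂ} (hk : Continuous k)
    (hb : ∃ C : ℝ, ∀ p, ‖k p‖ ≤ C) :
    ∃ κ : 𝓢'(Phase d × Phase d, ℂ), ∀ φ : 𝓢(Phase d × Phase d, ℂ),
      Integrable (fun p => k p * φ p) ∧ κ φ = ∫ p, k p * φ p := by
  obtain ⟨C, hC⟩ := hb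
  have hm : MemLp k ⊤ := memLp_top_of_bound hk.aestronglyMeasurable C
    (Filter.Eventually.of_forall hC)
  refine ⟨Lp.toTemperedDistribution (hm.toLp k), fun φ => ⟨?_, ?_⟩⟩
  · exact φ.integrable.bdd_mul (c := C) hk.aestronglyMeasurable (Filter.Eventually.of_forall hC)
  · rw [Lp.toTemperedDistribution_apply]
    refine integral_congr_ae ?_
    filter_upwards [hm.coeFn_toLp] with p hp
    rw [hp, smul_eq_mul, mul_comm]

/-- The Schwartz function `e^{2πiΦ} σ`. -/
def phaseSymbol (Φ : Phase d → ℝ) (σ : 𝓢(Phase d, ℂ)) : 𝓢(Phase d, ℂ) :=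
  smulLeftCLM ℂ (fun z => Complex.exp (2 * Real.pi * Complex.I * (Φ z : ℂ))) σ

variable {Φ : Phase d → ℝ}

theorem phaseSymbol_apply (hΦ : IsTamePhase Φ) (σ : 𝓢(Phase d, ℂ)) (z : Phase d) :
    phaseSymbol Φ σ z = Complex.exp (2 * Real.pi * Complex.I * (Φ z : ℂ)) * σ z :=
  smulLeftCLM_apply_apply
    (hasTemperateGrowth_of_bounded_iteratedFDeriv hΦ.smooth hΦ.bounded).cexp_two_pi_I σ z

theorem fioI_eq_kernelOp (hΦ : IsTamePhase Φ) (σ : 𝓢(Phase d, ℂ)) :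
    fioI Φ σ = kernelOp (phaseSymbol Φ σ) := by
  ext f x
  simp only [fioI, kernelOp, phaseSymbol_apply hΦ]

/-- The amplitude `sigmaTilde Φ σ z` as a Schwartz function. -/
def amplitude (Φ : Phase d → ℝ) (σ : 𝓢(Phase d, ℂ)) (z : Phase d) : 𝓢(Phase d, ℂ) :=
  smulLeftCLM ℂ (fun u => Complex.exp (2 * Real.pi * Complex.I * ((-fderiv ℝ Φ z u : ℝ) : ℂ)))
    (slice (midTensor (phaseSymbol Φ σ) (phaseSymbol Φ σ)) z)

theorem amplitude_apply (σ : 𝓢(Phase d, ℂ)) (z u : Phase d) :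
    amplitude Φ σ z u =
      osc (fderiv ℝ Φ z u) * midTensor (phaseSymbol Φ σ) (phaseSymbol Φ σ) (z, u) := by
  have h : Function.HasTemperateGrowth fun u => -fderiv ℝ Φ z u :=
    (-fderiv ℝ Φ z).hasTemperateGrowth
  rw [amplitude, smulLeftCLM_apply_apply h.cexp_two_pi_I, slice_apply, osc_eq, smul_eq_mul]

/-- By Taylor's formula `Φ₂ - Φ̃₂` is the phase difference at `z ± u/2` minus its linear part. Hence
`σ̃(z,·)` is Schwartz, from which its smoothness and integrability follow. -/
theorem coe_amplitude (hΦ : IsTamePhase Φ) (σ : 𝓢(Phase d, ℂ)) (z : Phase d) :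
    (amplitude Φ σ z : Phase d → ℂ) = sigmaTilde Φ σ z := by
  ext u
  have h : ∀ s : ℝ, Complex.exp (2 * Real.pi * Complex.I * (s : ℂ)) = osc (-s) := fun s => by
    rw [osc_eq, neg_neg]
  rw [amplitude_apply, midTensor_apply, phaseSymbol_apply hΦ, phaseSymbol_apply hΦ, sigmaTilde,
    taylorPlus_sub_taylorMinus hΦ.smooth, h, h, h, map_mul, conj_osc,
    show -(Φ (z + (1 / 2 : ℝ) • u) - Φ (z - (1 / 2 : ℝ) • u) - fderiv ℝ Φ z u) =
      fderiv ℝ Φ z u + (-Φ (z + (1 / 2 : ℝ) • u) + - -Φ (z - (1 / 2 : ℝ) • u)) by ring,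
    osc_add, osc_add]
  ring

theorem wignerKernel_eq_integral_sigmaTilde (hΦ : IsTamePhase Φ) (σ : 𝓢(Phase d, ℂ))
    (x ξ y η : Rd d) :
    wignerKernel (phaseSymbol Φ σ) (pt x ξ, pt y η) = ∫ p : Rd d × Rd d,
      osc (inner ℝ p.1 (ξ - gradX Φ x η) + inner ℝ p.2 (y - gradEta Φ x η)) *
        sigmaTilde Φ σ (pt x η) (pt p.1 p.2) := by
  rw [wignerKernel_eq]
  refine integral_congr_ae (Filter.Eventually.of_forall fun p => ?_)
  simp only
  rw [← coe_amplitude hΦ, amplitude_apply, ← mul_assoc, ← osc_add, fderiv_eq_inner_grad hΦ.smooth]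
  congr 2
  change _ = _ + (inner ℝ p.1 _ + inner ℝ p.2 _)
  simp only [inner_sub_right]
  ring

theorem wignerKernel_eq_fourier (hΦ : IsTamePhase Φ) (σ : 𝓢(Phase d, ℂ)) (x ξ y η : Rd d) :
    wignerKernel (phaseSymbol Φ σ) (pt x ξ, pt y η) =
      𝓕 (amplitude Φ σ (pt x η)) (pt (ξ - gradX Φ x η) (y - gradEta Φ x η)) := by
  rw [wignerKernel_eq_integral_sigmaTilde hΦ, fourier_coe, fourier_eq_osc, integral_phase,
    coe_amplitude hΦ]
  refine integral_congr_ae (Filter.Eventually.of_forall fun p => ?_)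
  simp only [inner_pt]
  rfl

theorem coe_iterate_oneSubLaplacian_amplitude (hΦ : IsTamePhase Φ) (σ : 𝓢(Phase d, ℂ)) (N : ℕ)
    (z : Phase d) : ((oneSubLaplacian^[N] (amplitude Φ σ z) : 𝓢(Phase d, ℂ)) : Phase d → ℂ) =
      ampl Φ σ N z := by
  rw [coe_iterate_oneSubLaplacian, coe_amplitude hΦ, ampl]

/-- The bracket lists the two blocks in the opposite order to the frequency variable, which leaves
the Euclidean norm unchanged. -/
theorem bracket_pow (a b : Rd d) (N : ℕ) :
    bracket ((2 * Real.pi) • pt a b) ^ (2 * N) = (1 + (2 * Real.pi) ^ 2 * ‖pt b a‖ ^ 2) ^ N := by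
  have h : ‖pt a b‖ ^ 2 = ‖pt b a‖ ^ 2 := by
    rw [WithLp.prod_norm_sq_eq_of_L2, WithLp.prod_norm_sq_eq_of_L2, add_comm]
    rfl
  rw [bracket, pow_mul, Real.sq_sqrt (by positivity), norm_smul, mul_pow, h, Real.norm_eq_abs,
    sq_abs]

theorem wignerKernel_eq_fourier_ampl (hΦ : IsTamePhase Φ) (σ : 𝓢(Phase d, ℂ)) (N : ℕ)
    (x ξ y η : Rd d) :
    wignerKernel (phaseSymbol Φ σ) (pt x ξ, pt y η) =
      (1 / ((bracket ((2 * Real.pi) •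
        pt (y - gradEta Φ x η) (ξ - gradX Φ x η)) ^ (2 * N) : ℝ) : ℂ)) *
        fourier₂ (ampl Φ σ N) (pt x η) (pt (ξ - gradX Φ x η) (y - gradEta Φ x η)) := by
  rw [fourier₂, ← coe_iterate_oneSubLaplacian_amplitude hΦ, ← fourier_coe,
    fourier_iterate_oneSubLaplacian, wignerKernel_eq_fourier hΦ, bracket_pow, ← mul_assoc,
    Complex.ofReal_pow, one_div, inv_mul_cancel₀, one_mul]
  refine pow_ne_zero _ (Complex.ofReal_ne_zero.2 ?_)
  positivity

theorem isWignerKernel_wignerKernel (H : 𝓢(Phase d, ℂ)) {κ : 𝓢'(Phase d × Phase d, ℂ)}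
    (hκ : ∀ φ : 𝓢(Phase d × Phase d, ℂ), Integrable (fun p => wignerKernel H p * φ p) ∧
      κ φ = ∫ p, wignerKernel H p * φ p) :
    IsWignerKernel (kernelOp H) κ := by
  refine ⟨memLp_kernelOp H, fun f g u v Ψ hΨ => ?_⟩
  rw [(hκ Ψ).2]
  refine Eq.trans ?_ (integral_prod _ (hκ Ψ).1).symm
  refine integral_congr_ae (Filter.Eventually.of_forall fun z => ?_)
  simp only
  change crossWigner _ _ (pt z.fst z.snd) * _ = _
  rw [crossWigner_kernelOp, ← integral_mul_const]
  refine integral_congr_ae (Filter.Eventually.of_forall fun w => ?_)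
  simp only [hΨ]
  change wignerKernel H (z, w) * _ * _ = _
  ring

end WignerFIO

/-! ### Uniqueness of the Wigner kernel -/

namespace WignerFIO

open SchwartzMap

variable {d : ℕ}

theorem exists_crossWigner_eq_gaussian : ∃ c : ℂ, c ≠ 0 ∧ ∀ β : Phase d, ∃ f g : 𝓢(Rd d, ℂ),
    ∀ z, crossWigner f g z = c * (Complex.exp (2 * Real.pi * Complex.I * (inner ℝ β z : ℂ)) *
      (Real.exp (-(2 * Real.pi) * ‖z‖ ^ 2) : ℂ)) := by
  have hπ : (0 : ℝ) < Real.pi / 2 := by positivity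
  -- The constant `2^{d/2}` is the normalisation of the Fourier transform of `e^{-π|t|²/2}`.
  refine ⟨(Real.pi / ((Real.pi / 2 : ℝ) : ℂ)) ^ (Module.finrank ℝ (Rd d) / 2 : ℂ), ?_,
    fun β => ?_⟩
  · refine (Complex.cpow_ne_zero_iff).2 (Or.inl ?_)
    exact div_ne_zero (Complex.ofReal_ne_zero.2 Real.pi_ne_zero) (Complex.ofReal_ne_zero.2 hπ.ne')
  let G : 𝓢(Rd d, ℂ) := gaussianSchwartz (Rd d) Real.pi_pos
  have hl : ∀ a : Rd d, Function.HasTemperateGrowth fun x : Rd d => inner ℝ a x := fun a =>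
    (innerSL ℝ a).hasTemperateGrowth
  let F : Rd d → Rd d → 𝓢(Rd d, ℂ) := fun a b =>
    smulLeftCLM ℂ (fun x => Complex.exp (2 * Real.pi * Complex.I * ((inner ℝ a x : ℝ) : ℂ)))
      (G.compSubConstCLM ℂ b)
  have hF : ∀ a b x, F a b x = osc (-inner ℝ a x) * (Real.exp (-Real.pi * ‖x - b‖ ^ 2) : ℂ) :=
    fun a b x => by
      simp only [F]
      rw [smulLeftCLM_apply_apply (hl a).cexp_two_pi_I, compSubConstCLM_apply,
        gaussianSchwartz_apply, osc_eq, neg_neg, smul_eq_mul]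
  -- Opposite modulations `±β₁/2` produce `e^{2πi β₁·x}`. Opposite centres `∓β₂/2` turn the Gaussian
  -- product into `e^{-2π|x|²} e^{-π|t+β₂|²/2}`, whose Fourier transform in `t` carries the factor
  -- `e^{2πi β₂·ξ}`.
  refine ⟨F ((1 / 2 : ℝ) • β.fst) (-((1 / 2 : ℝ) • β.snd)),
    F (-((1 / 2 : ℝ) • β.fst)) ((1 / 2 : ℝ) • β.snd), fun z => ?_⟩
  have hmid : ∀ t, midTensor (F ((1 / 2 : ℝ) • β.fst) (-((1 / 2 : ℝ) • β.snd)))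
      (F (-((1 / 2 : ℝ) • β.fst)) ((1 / 2 : ℝ) • β.snd)) (z.fst, t) =
      osc (-inner ℝ β.fst z.fst) * (Real.exp (-(2 * Real.pi) * ‖z.fst‖ ^ 2) : ℂ) *
        Complex.exp (-((Real.pi / 2 : ℝ) : ℂ) * (‖t + β.snd‖ : ℂ) ^ 2) := fun t => by
    rw [midTensor_apply, hF, hF, map_mul, conj_osc, Complex.conj_ofReal]
    have e1 : osc (-inner ℝ β.fst z.fst) =
        osc (-inner ℝ ((1 / 2 : ℝ) • β.fst) (z.fst + (1 / 2 : ℝ) • t)) *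
          osc (- -inner ℝ (-((1 / 2 : ℝ) • β.fst)) (z.fst - (1 / 2 : ℝ) • t)) := by
      rw [← osc_add]
      congr 1
      simp only [inner_add_right, inner_sub_right, inner_neg_left, real_inner_smul_left,
        real_inner_smul_right]
      ring
    have e2 : (Real.exp (-(2 * Real.pi) * ‖z.fst‖ ^ 2) : ℂ) *
        Complex.exp (-((Real.pi / 2 : ℝ) : ℂ) * (‖t + β.snd‖ : ℂ) ^ 2) =
        (Real.exp (-Real.pi * ‖z.fst + (1 / 2 : ℝ) • t - -((1 / 2 : ℝ) • β.snd)‖ ^ 2) : ℂ) *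
        (Real.exp (-Real.pi * ‖z.fst - (1 / 2 : ℝ) • t - (1 / 2 : ℝ) • β.snd‖ ^ 2) : ℂ) := by
      have e3 : z.fst + (1 / 2 : ℝ) • t - -((1 / 2 : ℝ) • β.snd) =
        z.fst + (1 / 2 : ℝ) • (t + β.snd) := by module
      have e4 : z.fst - (1 / 2 : ℝ) • t - (1 / 2 : ℝ) • β.snd =
        z.fst - (1 / 2 : ℝ) • (t + β.snd) := by module
      rw [e3, e4, norm_add_sq_real, norm_sub_sq_real, norm_smul, Real.norm_of_nonneg (by norm_num)]
      push_cast
      rw [← Complex.exp_add, ← Complex.exp_add]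
      congr 1
      ring
    rw [e1, mul_assoc (_ * _), e2]
    ring
  have hz : ‖z‖ ^ 2 = ‖z.fst‖ ^ 2 + ‖z.snd‖ ^ 2 := WithLp.prod_norm_sq_eq_of_L2 z
  have hβ : inner ℝ β z = inner ℝ β.fst z.fst + inner ℝ β.snd z.snd := by
    rw [WithLp.prod_inner_apply]
    rfl
  have hsh := integral_sub_right_eq_self (μ := volume) (fun t : Rd d =>
    osc (inner ℝ t z.snd) * Complex.exp (-((Real.pi / 2 : ℝ) : ℂ) * (‖t + β.snd‖ : ℂ) ^ 2)) β.snd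
  rw [crossWigner_eq, partialFourier, fourier_coe, fourier_eq_osc]
  simp_rw [slice_apply, hmid]
  have e5 : ∀ t, osc (inner ℝ t z.snd) * (osc (-inner ℝ β.fst z.fst) *
      (Real.exp (-(2 * Real.pi) * ‖z.fst‖ ^ 2) : ℂ) *
        Complex.exp (-((Real.pi / 2 : ℝ) : ℂ) * (‖t + β.snd‖ : ℂ) ^ 2)) =
      osc (-inner ℝ β.fst z.fst) * (Real.exp (-(2 * Real.pi) * ‖z.fst‖ ^ 2) : ℂ) *
      (osc (inner ℝ t z.snd) *
        Complex.exp (-((Real.pi / 2 : ℝ) : ℂ) * (‖t + β.snd‖ : ℂ) ^ 2)) := fun t => by ring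
  simp_rw [e5]
  rw [integral_const_mul, ← hsh]
  simp only [sub_add_cancel]
  have e6 : ∀ t, osc (inner ℝ (t - β.snd) z.snd) * Complex.exp (-((Real.pi / 2 : ℝ) : ℂ) *
      (‖t‖ : ℂ) ^ 2) = osc (-inner ℝ β.snd z.snd) * (osc (inner ℝ t z.snd) *
        Complex.exp (-((Real.pi / 2 : ℝ) : ℂ) * (‖t‖ : ℂ) ^ 2)) := fun t => by
    rw [inner_sub_left, sub_eq_neg_add, osc_add]
    ring
  simp_rw [e6]
  rw [integral_const_mul, ← fourier_eq_osc, fourier_gaussian_innerProductSpace (by simpa using hπ),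
    hz, hβ]
  have e7 : Complex.exp (2 * Real.pi * Complex.I *
      ((inner ℝ β.fst z.fst + inner ℝ β.snd z.snd : ℝ) : ℂ)) =
      osc (-inner ℝ β.fst z.fst) * osc (-inner ℝ β.snd z.snd) := by
    rw [← osc_add, osc_eq]
    congr 3
    ring
  have e8 : (Real.exp (-(2 * Real.pi) * (‖z.fst‖ ^ 2 + ‖z.snd‖ ^ 2)) : ℂ) =
      (Real.exp (-(2 * Real.pi) * ‖z.fst‖ ^ 2) : ℂ) *
      Complex.exp (-Real.pi ^ 2 * ‖z.snd‖ ^ 2 / ((Real.pi / 2 : ℝ) : ℂ)) := by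
    push_cast
    rw [← Complex.exp_add]
    congr 1
    have : (Real.pi : ℂ) ≠ 0 := Complex.ofReal_ne_zero.2 Real.pi_ne_zero
    field_simp
    ring
  rw [e7, e8]
  ring

theorem IsWignerKernel.unique {T : 𝓢(Rd d, ℂ) → Rd d → ℂ} {κ κ' : 𝓢'(Phase d × Phase d, ℂ)}
    (hκ : IsWignerKernel T κ) (hκ' : IsWignerKernel T κ') : κ' = κ := by
  obtain ⟨c, hc, hW⟩ := exists_crossWigner_eq_gaussian (d := d)
  -- The product `Phase d × Phase d` has the sup norm. Totality of modulated Gaussians needs an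
  -- inner product space, so the functional is transported to the `L²` product.
  let L := WithLp.prodContinuousLinearEquiv 2 ℝ (Phase d) (Phase d)
  let D : 𝓢(WithLp 2 (Phase d × Phase d), ℂ) →L[ℂ] ℂ :=
    (show 𝓢(Phase d × Phase d, ℂ) →L[ℂ] ℂ from κ' - κ).comp
      (compCLMOfContinuousLinearEquiv ℂ L.symm)
  have hD : ∀ φ, D φ = κ' (compCLMOfContinuousLinearEquiv ℂ L.symm φ) -
      κ (compCLMOfContinuousLinearEquiv ℂ L.symm φ) := fun φ => rfl
  have h0 := SchwartzMap.eq_zero_of_modulated_gaussian (c := 2 * Real.pi) (by positivity) D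
    (fun β φ hφ => ?_)
  · ext φ
    have := h0 (compCLMOfContinuousLinearEquiv ℂ L φ)
    rw [hD, sub_eq_zero] at this
    have e : compCLMOfContinuousLinearEquiv ℂ L.symm (compCLMOfContinuousLinearEquiv ℂ L φ) =
        φ := by
      ext p
      simp [compCLMOfContinuousLinearEquiv_apply]
    rwa [e] at this
  -- The sign compensates for the complex conjugate on `W(u,v)`.
  · obtain ⟨u, v, huv⟩ := hW (-β.fst)
    obtain ⟨f, g, hfg⟩ := hW β.snd
    have hΨ : ∀ z w, ((conj c * c) • compCLMOfContinuousLinearEquiv ℂ L.symm φ :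
        𝓢(Phase d × Phase d, ℂ)) (z, w) = conj (crossWigner u v z) * crossWigner f g w :=
      fun z w => by
        have e : (compCLMOfContinuousLinearEquiv ℂ L.symm φ) (z, w) = φ (WithLp.toLp 2 (z, w)) :=
          rfl
        have e1 : inner ℝ β (WithLp.toLp 2 (z, w)) = inner ℝ β.fst z + inner ℝ β.snd w := by
          rw [WithLp.prod_inner_apply]
          rfl
        have e2 : ‖WithLp.toLp 2 (z, w)‖ ^ 2 = ‖z‖ ^ 2 + ‖w‖ ^ 2 :=
          WithLp.prod_norm_sq_eq_of_L2 _
        rw [smul_apply, e, hφ, huv, hfg, e1, e2, map_mul, map_mul, Complex.conj_ofReal,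
          ← Complex.exp_conj, inner_neg_left, mul_add, Real.exp_add]
        simp only [map_mul, Complex.conj_I, Complex.conj_ofReal, Complex.conj_ofNat]
        push_cast
        rw [mul_add, Complex.exp_add, smul_eq_mul]
        ring_nf
    have h1 := hκ.2 f g u v _ hΨ
    rw [hκ'.2 f g u v _ hΨ, map_smul, map_smul] at h1
    rw [hD, sub_eq_zero]
    exact smul_right_injective ℂ (mul_ne_zero ((map_ne_zero _).2 hc) hc) h1

end WignerFIO

end

open WignerFIO in
theorem theorem5p7 (d : ℕ) (Φ : Phase d → ℝ) (hΦ : IsTamePhase Φ) (σ : 𝓢(Phase d, ℂ)) :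
    ∃ (κ : 𝓢'(Phase d × Phase d, ℂ)) (k : Phase d × Phase d → ℂ),
      -- `κ` is the (unique) Wigner kernel of the FIO
      IsWignerKernel (fioI Φ σ) κ ∧
      (∀ κ' : 𝓢'(Phase d × Phase d, ℂ), IsWignerKernel (fioI Φ σ) κ' → κ' = κ) ∧
      -- it is given by the continuous function `k`
      Continuous k ∧
      (∀ φ : 𝓢(Phase d × Phase d, ℂ),
        Integrable (fun p => k p * φ p) ∧ κ φ = ∫ p, k p * φ p) ∧
      -- the amplitude is smooth in `u = (t, r)`
      (∀ z : Phase d, ContDiff ℝ (⊤ : ℕ∞) (sigmaTilde Φ σ z)) ∧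
      -- the oscillatory integral formula for `k`
      (∀ x ξ y η : Rd d,
        Integrable (fun p : Rd d × Rd d => sigmaTilde Φ σ (pt x η) (pt p.1 p.2)) ∧
        k (pt x ξ, pt y η) =
          ∫ p : Rd d × Rd d,
            Complex.exp (-(2 * Real.pi * Complex.I *
              ((inner ℝ p.1 (ξ - gradX Φ x η) + inner ℝ p.2 (y - gradEta Φ x η) : ℝ) : ℂ))) *
            sigmaTilde Φ σ (pt x η) (pt p.1 p.2)) ∧
      -- the formula obtained from it for every `N`
      (∀ (N : ℕ) (x ξ y η : Rd d),
        Integrable (ampl Φ σ N (pt x η)) ∧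
        k (pt x ξ, pt y η) =
          (1 / ((bracket ((2 * Real.pi) •
              pt (y - gradEta Φ x η) (ξ - gradX Φ x η)) ^ (2 * N) : ℝ) : ℂ)) *
            fourier₂ (ampl Φ σ N) (pt x η)
              (pt (ξ - gradX Φ x η) (y - gradEta Φ x η))) := by
  obtain ⟨κ, hκ⟩ := exists_distribution (continuous_wignerKernel (phaseSymbol Φ σ))
    (exists_norm_wignerKernel_le _)
  have hW : IsWignerKernel (fioI Φ σ) κ := by
    rw [fioI_eq_kernelOp hΦ]
    exact isWignerKernel_wignerKernel _ hκ
  refine ⟨κ, wignerKernel (phaseSymbol Φ σ), hW, fun κ' hκ' => hW.unique hκ',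
    continuous_wignerKernel _, hκ, fun z => ?_, fun x ξ y η => ⟨?_, ?_⟩,
    fun N x ξ y η => ⟨?_, wignerKernel_eq_fourier_ampl hΦ σ N x ξ y η⟩⟩
  · rw [← coe_amplitude hΦ]
    exact (amplitude Φ σ z).smooth ⊤
  · rw [← coe_amplitude hΦ]
    exact integrable_phase (amplitude Φ σ (pt x η)).integrable
  · exact wignerKernel_eq_integral_sigmaTilde hΦ σ x ξ y η
  · rw [← coe_iterate_oneSubLaplacian_amplitude hΦ]
    exact SchwartzMap.integrable _
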